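/- For $d,n\ge 1$ let $x_{i,j}$ ($1\le i\le d$, $1\le j\le n$) be real numbers with $x_{i,1}=1$ and $K_i x_{i,j}\le x_{i,j+1}$ for all $1\le i\le d$, $1\le j<n$, where $K_1=2^d$ and $K_i=2^d x_{i-1,n}$ for $2\le i\le d$. The set $D_s(n)=\{(x_{1,j},\dots,x_{d,j}) : 1\le j\le n\}\subset\mathbb R^d$ is called a stretched diagonal. A simplex spanned by a finite set $X\subset\mathbb R^d$ is the convex hull of affinely independent points of $X$; a flat stabs a simplex if it intersects it. For $0\le k<d$ let $c_{d,k}$ be the supremum of all $c\in\mathbb R$ such that, for every $n$-point set $X\subset\mathbb R^d$ in general position (any at most $d+1$ points of $X$ are affinely independent), some $k$-flat stabs at least $c\,n^{d-k+1}-O(n^{d-k})$ of the $(d-k)$-dimensional simplices spanned by $X$, where the implied constant may depend on $c,d,k$ but not on $X$. Let $d=3$. Then every line in $\mathbb R^3$ stabs at most $\frac1{25}n^3+o(n^3)$ of the triangles spanned by the stretched diagonal $D_s(n)$, where the error term depends only on $n$ (not on the line or on the choice of the $x_{i,j}$). Consequently, the set of constants $c$ defining $c_{3,1}$ is bounded above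 and $c_{3,1}\le \frac1{25}$. -/

import Mathlib

open Filter Asymptotics

noncomputable section

/-- `F` is a `k`-flat of `ℝ^d`: a nonempty affine subspace of dimension `k`. -/
def IsFlat {d : ℕ} (k : ℕ) (F : AffineSubspace ℝ (EuclideanSpace ℝ (Fin d))) : Prop :=
  (F : Set (EuclideanSpace ℝ (Fin d))).Nonempty ∧ Module.finrank ℝ F.direction = k

/-- The number of `m`-dimensional simplices spanned by `X` that `F` stabs. A simplex is recorded by
its vertex set: `m + 1` affinely independent points of `X`. It is stabbed by `F` if its (closed)
convex hull meets `F`. -/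
def stabCount {d : ℕ} (m : ℕ) (X : Finset (EuclideanSpace ℝ (Fin d)))
    (F : AffineSubspace ℝ (EuclideanSpace ℝ (Fin d))) : ℕ :=
  {T : Finset (EuclideanSpace ℝ (Fin d)) | T ⊆ X ∧ T.card = m + 1 ∧
    AffineIndependent ℝ (fun v : T => (v : EuclideanSpace ℝ (Fin d))) ∧
    (convexHull ℝ (T : Set (EuclideanSpace ℝ (Fin d))) ∩
      (F : Set (EuclideanSpace ℝ (Fin d)))).Nonempty}.ncard

/-- General position in `ℝ^d`: any at most `d + 1` points of `X` are affinely independent. -/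
def InGeneralPosition {d : ℕ} (X : Finset (EuclideanSpace ℝ (Fin d))) : Prop :=
  ∀ T ⊆ X, T.card ≤ d + 1 →
    AffineIndependent ℝ (fun v : T => (v : EuclideanSpace ℝ (Fin d)))

/-- The constants `c` such that for every `n`-point set `X ⊆ ℝ^d` in general position some `k`-flat
stabs at least `c n^(d-k+1) - O(n^(d-k))` of the `(d-k)`-simplices spanned by `X`; the implied
constant `C` does not depend on `X`. -/
def selectionConstants (d k : ℕ) : Set ℝ :=
  {c | ∃ C : ℝ, ∀ X : Finset (EuclideanSpace ℝ (Fin d)), InGeneralPosition X →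
    ∃ F : AffineSubspace ℝ (EuclideanSpace ℝ (Fin d)), IsFlat k F ∧
      c * (X.card : ℝ) ^ (d - k + 1) - C * (X.card : ℝ) ^ (d - k) ≤ stabCount (d - k) X F}

/-- The selection constant `c_{d,k}`, the largest (supremal) value of the constants above. -/
def selectionConstant (d k : ℕ) : ℝ := sSup (selectionConstants d k)

/-- The factor `K_i` by which the `i`-th axis grows: `K_1 = 2^d`, and `K_i = 2^d x_{i-1,n}` for
`2 ≤ i ≤ d`. Axes and layers are numbered from `1`. -/
def growthFactor (d n : ℕ) (x : ℕ → ℕ → ℝ) (i : ℕ) : ℝ :=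
  if i = 1 then 2 ^ d else 2 ^ d * x (i - 1) n

/-- `x i j`, for `1 ≤ i ≤ d` and `1 ≤ j ≤ n`, are the coordinates `x_{i,j}` of the axes of a
stretched grid: `x_{i,1} = 1` and `K_i x_{i,j} ≤ x_{i,j+1}`. Other values of `x` are irrelevant. -/
structure IsStretched (d n : ℕ) (x : ℕ → ℕ → ℝ) : Prop where
  first : ∀ i, 1 ≤ i → i ≤ d → x i 1 = 1
  growth : ∀ i j, 1 ≤ i → i ≤ d → 1 ≤ j → j < n → growthFactor d n x i * x i j ≤ x i (j + 1)

open Classical in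
/-- The stretched diagonal `D_s(n) = {(x_{1,j}, …, x_{d,j}) : 1 ≤ j ≤ n}`. -/
def stretchedDiagonal (d n : ℕ) (x : ℕ → ℕ → ℝ) : Finset (EuclideanSpace ℝ (Fin d)) :=
  (Finset.Icc 1 n).image fun j => WithLp.toLp 2 fun i : Fin d => x ((i : ℕ) + 1) j

end

/-! Let `D s t` be the determinant of `p_s - q`, `p_t - q` and `w`, for the line through `q` with
direction `w`. It is antisymmetric, so its signs form a tournament on the indices. If the line meets
the triangle `p_a p_b p_c` and no `D` vanishes on its pairs, the triple is cyclic in this tournament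
(`cyclic_of_stabs`). The task is to bound the number of cyclic triples.

`D s t` is the sum of six Plücker coordinates times 2×2 minors. On a stretched diagonal each minor
is close to its diagonal term, and except near a few indices one of the six products dwarfs the
others and fixes the sign of `D` (`sign_eq_lead`). Which one wins depends only on the position of
`s` and `t` relative to five thresholds. An index is near a threshold at most four times, so at most
20 indices are discarded, which costs `O(n ^ 2)` triangles.

Five thresholds would cut the indices into six intervals. The Plücker relation makes one of them
redundant (`exists_redundant_threshold`), so five intervals remain, and the sign of `D` depends only
on the intervals of its arguments. Cyclic triples then use three different intervals, so their
number is at most the cyclic weight of a five-vertex tournament weighted by interval sizes `r`.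
Counting by signed scores, 24 times this weight is at most `(∑ r) ^ 3 - ∑ r ^ 3`. The power mean
inequality bounds that by `(1 - 1 / 25) (∑ r) ^ 3`, and dividing by 24 gives `1 / 25`. -/

/-! ### Cyclic triples in a tournament with five interval classes -/

/-- In a weighted tournament on five vertices whose edges are recorded by signs, the cyclic triples
have total weight at most `1 / 25` of the cube of the total weight. -/
lemma sum_cyclic_weight_le (r : Fin 5 → ℝ) (hr : ∀ i, 0 ≤ r i) (s : Fin 5 → Fin 5 → ℝ)
    (hs : ∀ i j, s i j ^ 2 = 1) :
    ∑ i, ∑ j, ∑ k, (if i < j ∧ j < k then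
      r i * r j * r k * ((1 + s i j * s j k - s i j * s i k - s i k * s j k) / 4) else 0) ≤
      1 / 25 * (∑ i, r i) ^ 3 := by
  have hp : (∑ i, r i) ^ 3 ≤ 25 * ∑ i, r i ^ 3 := by
    have h := pow_sum_div_card_le_sum_pow (s := Finset.univ) (f := r) (n := 2)
      (fun i _ => hr i)
    norm_num at h
    linarith
  have hq : 0 ≤ 3 * (r 0 * (s 0 1 * r 1 + s 0 2 * r 2 + s 0 3 * r 3 + s 0 4 * r 4) ^ 2 +
      r 1 * (-s 0 1 * r 0 + s 1 2 * r 2 + s 1 3 * r 3 + s 1 4 * r 4) ^ 2 +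
      r 2 * (-s 0 2 * r 0 - s 1 2 * r 1 + s 2 3 * r 3 + s 2 4 * r 4) ^ 2 +
      r 3 * (-s 0 3 * r 0 - s 1 3 * r 1 - s 2 3 * r 2 + s 3 4 * r 4) ^ 2 +
      r 4 * (-s 0 4 * r 0 - s 1 4 * r 1 - s 2 4 * r 2 - s 3 4 * r 3) ^ 2) := by
    have h0 := hr 0
    have h1 := hr 1
    have h2 := hr 2
    have h3 := hr 3
    have h4 := hr 4
    positivity
  -- The factor `(1 + ...) / 4` is 1 on cyclic triples and 0 on transitive ones. The squares are the
  -- weighted scores, out-edges minus in-edges; expanding them yields the same mixed products of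
  -- signs.
  have key : 24 * ∑ i, ∑ j, ∑ k, (if i < j ∧ j < k then
      r i * r j * r k * ((1 + s i j * s j k - s i j * s i k - s i k * s j k) / 4) else 0) =
      (∑ i, r i) ^ 3 - ∑ i, r i ^ 3 -
      3 * (r 0 * (s 0 1 * r 1 + s 0 2 * r 2 + s 0 3 * r 3 + s 0 4 * r 4) ^ 2 +
      r 1 * (-s 0 1 * r 0 + s 1 2 * r 2 + s 1 3 * r 3 + s 1 4 * r 4) ^ 2 +
      r 2 * (-s 0 2 * r 0 - s 1 2 * r 1 + s 2 3 * r 3 + s 2 4 * r 4) ^ 2 +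
      r 3 * (-s 0 3 * r 0 - s 1 3 * r 1 - s 2 3 * r 2 + s 3 4 * r 4) ^ 2 +
      r 4 * (-s 0 4 * r 0 - s 1 4 * r 1 - s 2 4 * r 2 - s 3 4 * r 3) ^ 2) := by
    simp [Fin.sum_univ_five]
    linear_combination 3 * (r 0 * r 1 * (r 0 + r 1)) * hs 0 1 +
      3 * (r 0 * r 2 * (r 0 + r 2)) * hs 0 2 + 3 * (r 0 * r 3 * (r 0 + r 3)) * hs 0 3 +
      3 * (r 0 * r 4 * (r 0 + r 4)) * hs 0 4 + 3 * (r 1 * r 2 * (r 1 + r 2)) * hs 1 2 +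
      3 * (r 1 * r 3 * (r 1 + r 3)) * hs 1 3 + 3 * (r 1 * r 4 * (r 1 + r 4)) * hs 1 4 +
      3 * (r 2 * r 3 * (r 2 + r 3)) * hs 2 3 + 3 * (r 2 * r 4 * (r 2 + r 4)) * hs 2 4 +
      3 * (r 3 * r 4 * (r 3 + r 4)) * hs 3 4
  linarith

/-- Among five monotone predicates one of which is determined by the others, at most five truth
patterns occur on a set of indices, and they occur in successive intervals. -/
lemma exists_interval_classes (G : Finset ℕ) (π : Fin 5 → ℕ → Prop)
    (mono : ∀ k, ∀ s ∈ G, ∀ t ∈ G, s ≤ t → π k s → π k t) (k₀ : Fin 5)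
    (h : ∀ s ∈ G, ∀ t ∈ G, (∀ k ≠ k₀, (π k s ↔ π k t)) → (π k₀ s ↔ π k₀ t)) :
    ∃ cls : ℕ → Fin 5, (∀ s ∈ G, ∀ t ∈ G, s ≤ t → cls s ≤ cls t) ∧
      ∀ s ∈ G, ∀ t ∈ G, cls s = cls t → ∀ k, (π k s ↔ π k t) := by
  classical
  -- By monotonicity the sets of satisfied predicates form a chain, so their size, from 0 to 4,
  -- determines them and serves as the class.
  let F : ℕ → Finset (Fin 5) := fun s => (Finset.univ.erase k₀).filter (π · s)
  have hF : ∀ s, (F s).card < 5 := fun s =>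
    (Finset.card_filter_le _ _).trans_lt (by simp)
  have sub : ∀ s ∈ G, ∀ t ∈ G, s ≤ t → F s ⊆ F t := fun s hs t ht hst =>
    Finset.monotone_filter_right _ fun k _ => mono k s hs t ht hst
  refine ⟨fun s => ⟨(F s).card, hF s⟩, fun s hs t ht hst =>
    Finset.card_le_card (sub s hs t ht hst), fun s hs t ht hst => ?_⟩
  have hc : (F s).card = (F t).card := congrArg Fin.val hst
  have hst : F s = F t := by
    rcases le_total s t with hl | hl
    · exact Finset.eq_of_subset_of_card_le (sub s hs t ht hl) hc.ge
    · exact (Finset.eq_of_subset_of_card_le (sub t ht s hs hl) hc.le).symm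
  have h' : ∀ k ≠ k₀, (π k s ↔ π k t) := fun k hk => by
    have := Finset.ext_iff.1 hst k
    simpa [F, hk] using this
  intro k
  by_cases hk : k = k₀
  · exact hk ▸ h s hs t ht h'
  · exact h' k hk

/-- If the sign of `D a b`, `a < b`, depends only on which of five successive intervals contain `a`
and `b`, then at most `1 / 25` of the cube of the number of indices are cyclic triples. -/
lemma card_cyclic_triples_le (G : Finset ℕ) (D : ℕ → ℕ → ℝ) (cls : ℕ → Fin 5)
    (mono : ∀ s ∈ G, ∀ t ∈ G, s ≤ t → cls s ≤ cls t)
    (hD : ∀ a ∈ G, ∀ b ∈ G, ∀ a' ∈ G, ∀ b' ∈ G, a < b → a' < b' → cls a = cls a' →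
      cls b = cls b' → 0 < D a b * D a' b') :
    (((G ×ˢ G ×ˢ G).filter fun u => u.1 < u.2.1 ∧ u.2.1 < u.2.2 ∧
      0 < D u.1 u.2.1 * D u.2.1 u.2.2 ∧ D u.1 u.2.1 * D u.1 u.2.2 < 0).card : ℝ) ≤
      1 / 25 * (G.card : ℝ) ^ 3 := by
  classical
  let R : Fin 5 → Finset ℕ := fun i => G.filter (cls · = i)
  let pos : Fin 5 → Fin 5 → Prop := fun i j =>
    ∃ a ∈ G, ∃ b ∈ G, a < b ∧ cls a = i ∧ cls b = j ∧ 0 < D a b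
  -- Unrealised pairs of classes get the sign `-1`; this is harmless, since the weighted inequality
  -- holds for every choice of signs.
  let s : Fin 5 → Fin 5 → ℝ := fun i j => if pos i j then 1 else -1
  have hpos : ∀ a ∈ G, ∀ b ∈ G, a < b → (pos (cls a) (cls b) ↔ 0 < D a b) := by
    intro a ha b hb hab
    refine ⟨?_, fun h => ⟨a, ha, b, hb, hab, rfl, rfl, h⟩⟩
    rintro ⟨a', ha', b', hb', hab', h1, h2, h3⟩
    exact (pos_iff_pos_of_mul_pos (hD a' ha' b' hb' a ha b hb hab' hab h1 h2)).1 h3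
  have hs : ∀ i j, s i j ^ 2 = 1 := fun i j => by
    by_cases h : pos i j <;> simp [s, h]
  let C : Finset (Fin 5 × Fin 5 × Fin 5) := Finset.univ.filter fun v =>
    (v.1 < v.2.1 ∧ v.2.1 < v.2.2) ∧ (pos v.1 v.2.1 ↔ pos v.2.1 v.2.2) ∧
      ¬(pos v.1 v.2.1 ↔ pos v.1 v.2.2)
  have hsub : ((G ×ˢ G ×ˢ G).filter fun u => u.1 < u.2.1 ∧ u.2.1 < u.2.2 ∧
      0 < D u.1 u.2.1 * D u.2.1 u.2.2 ∧ D u.1 u.2.1 * D u.1 u.2.2 < 0) ⊆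
      C.biUnion fun v => R v.1 ×ˢ R v.2.1 ×ˢ R v.2.2 := by
    rintro ⟨a, b, c⟩ hu
    simp only [Finset.mem_filter, Finset.mem_product] at hu
    obtain ⟨⟨ha, hb, hc⟩, hab, hbc, h1, h2⟩ := hu
    have hac := hab.trans hbc
    have hneg : D a c * D b c < 0 := by
      by_contra hcon
      have : 0 ≤ (D a c * D b c) * (D a b) ^ 2 := mul_nonneg (not_lt.1 hcon) (sq_nonneg _)
      nlinarith [mul_neg_of_neg_of_pos h2 h1]
    -- Two members of a cyclic triple in one class would relate to the third with equal signs, so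
    -- the classes are distinct.
    have l1 : cls a < cls b := lt_of_le_of_ne (mono a ha b hb hab.le) fun h =>
      (hD a ha c hc b hb c hc hac hbc h rfl).not_gt hneg
    have l2 : cls b < cls c := lt_of_le_of_ne (mono b hb c hc hbc.le) fun h =>
      (hD a ha b hb a ha c hc hab hac rfl h).not_gt h2
    simp only [Finset.mem_biUnion, Finset.mem_product]
    refine ⟨(cls a, cls b, cls c), ?_, by simp [R, ha], by simp [R, hb], by simp [R, hc]⟩
    simp only [C, Finset.mem_filter, Finset.mem_univ, true_and]
    refine ⟨⟨l1, l2⟩, ?_, ?_⟩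
    · rw [hpos a ha b hb hab, hpos b hb c hc hbc]
      exact pos_iff_pos_of_mul_pos h1
    · rw [hpos a ha b hb hab, hpos a ha c hc hac]
      intro h
      rcases mul_neg_iff.1 h2 with ⟨p, q⟩ | ⟨p, q⟩
      · exact q.not_gt (h.1 p)
      · exact p.not_gt (h.2 q)
  have hcard : ((C.biUnion fun v => R v.1 ×ˢ R v.2.1 ×ˢ R v.2.2).card : ℝ) ≤
      ∑ i, ∑ j, ∑ k, (if i < j ∧ j < k then ((R i).card : ℝ) * (R j).card * (R k).card *
        ((1 + s i j * s j k - s i j * s i k - s i k * s j k) / 4) else 0) := by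
    calc ((C.biUnion fun v => R v.1 ×ˢ R v.2.1 ×ˢ R v.2.2).card : ℝ)
        ≤ ((∑ v ∈ C, (R v.1 ×ˢ R v.2.1 ×ˢ R v.2.2).card : ℕ) : ℝ) :=
          Nat.cast_le.2 Finset.card_biUnion_le
      _ ≤ _ := by
        simp only [C, Finset.sum_filter, Fintype.sum_prod_type, Nat.cast_sum]
        refine Finset.sum_le_sum fun i _ => Finset.sum_le_sum fun j _ =>
          Finset.sum_le_sum fun k _ => ?_
        by_cases h : i < j ∧ j < k
        · have hn : (0 : ℝ) ≤ (R i).card * (R j).card * (R k).card := by positivity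
          by_cases h1 : pos i j <;> by_cases h2 : pos j k <;> by_cases h3 : pos i k <;>
            simp [h, h1, h2, h3, s, Finset.card_product, mul_assoc] <;> norm_num
        · simp [h]
  have hsum : ∑ i, ((R i).card : ℝ) = G.card := by
    rw [← Nat.cast_sum, Finset.card_eq_sum_card_fiberwise (f := cls) (t := Finset.univ)
      (fun _ _ => Finset.mem_coe.2 (Finset.mem_univ _))]
  calc _ ≤ ((C.biUnion fun v => R v.1 ×ˢ R v.2.1 ×ˢ R v.2.2).card : ℝ) :=
        Nat.cast_le.2 (Finset.card_le_card hsub)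
    _ ≤ _ := hcard
    _ ≤ _ := sum_cyclic_weight_le (fun i => ((R i).card : ℝ)) (fun i => by positivity) s hs
    _ = _ := by rw [hsum]

/-! ### Sequences of geometric growth -/

section growth

variable {n : ℕ} {K : ℝ} {ξ : ℕ → ℝ}

lemma one_le_of_growth (hK : 1 ≤ K) (h1 : ξ 1 = 1)
    (hξ : ∀ j, 1 ≤ j → j < n → K * ξ j ≤ ξ (j + 1)) {j : ℕ} (hj : 1 ≤ j) (hjn : j ≤ n) :
    1 ≤ ξ j := by
  induction j, hj using Nat.le_induction with
  | base => exact h1.ge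
  | succ j hj ih =>
    have := ih (by omega)
    nlinarith [hξ j hj (by omega)]

lemma pow_mul_le_of_growth (hK : 1 ≤ K) (hξ : ∀ j, 1 ≤ j → j < n → K * ξ j ≤ ξ (j + 1))
    {s : ℕ} (hs : 1 ≤ s) (i : ℕ) (hi : s + i ≤ n) : K ^ i * ξ s ≤ ξ (s + i) := by
  induction i with
  | zero => simp
  | succ i ih =>
    have h1 := mul_le_mul_of_nonneg_left (ih (by omega)) (zero_le_one.trans hK)
    rw [pow_succ, ← add_assoc]
    linarith [hξ (s + i) (by omega) (by omega)]

lemma le_of_growth (hK : 1 ≤ K) (h1 : ξ 1 = 1)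
    (hξ : ∀ j, 1 ≤ j → j < n → K * ξ j ≤ ξ (j + 1)) {s t : ℕ} (hs : 1 ≤ s) (hst : s ≤ t)
    (ht : t ≤ n) : ξ s ≤ ξ t := by
  obtain ⟨i, rfl⟩ := Nat.exists_eq_add_of_le hst
  have := one_le_of_growth hK h1 hξ hs (by omega)
  nlinarith [pow_mul_le_of_growth hK hξ hs i ht, one_le_pow₀ hK (n := i)]

lemma mul_le_of_growth (hK : 1 ≤ K) (h1 : ξ 1 = 1)
    (hξ : ∀ j, 1 ≤ j → j < n → K * ξ j ≤ ξ (j + 1)) {s t : ℕ} (hs : 1 ≤ s) (hst : s < t)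
    (ht : t ≤ n) : K * ξ s ≤ ξ t :=
  (hξ s hs (by omega)).trans (le_of_growth hK h1 hξ (by omega) hst ht)

/-- A quantity growing by a factor `K` at each step is within the factor `K ^ 2` of a given value
at most four times. -/
lemma card_undecided_le {y z : ℝ} (hK : 1 ≤ K) (hy : 0 ≤ y) (h1 : ξ 1 = 1)
    (hξ : ∀ j, 1 ≤ j → j < n → K * ξ j ≤ ξ (j + 1)) :
    ((Finset.Icc 1 n).filter fun t =>
      ¬(K ^ 2 * z ≤ y * ξ t ∨ K ^ 2 * (y * ξ t) ≤ z)).card ≤ 4 := by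
  set B := (Finset.Icc 1 n).filter fun t => ¬(K ^ 2 * z ≤ y * ξ t ∨ K ^ 2 * (y * ξ t) ≤ z)
    with hB
  rcases B.eq_empty_or_nonempty with h | h
  · simp [h]
  have hmem : ∀ t ∈ B, t ∈ Finset.Icc 1 n ∧
      ¬(K ^ 2 * z ≤ y * ξ t ∨ K ^ 2 * (y * ξ t) ≤ z) := by
    rw [hB]
    exact fun t => Finset.mem_filter.1
  set m := B.min' h
  have hm := hmem m (B.min'_mem h)
  have hm1 := Finset.mem_Icc.1 hm.1
  have hm2 := not_or.1 hm.2
  have hsub : B ⊆ Finset.Ico m (m + 4) := by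
    intro t ht
    have ht' := hmem t ht
    have htn := (Finset.mem_Icc.1 ht'.1).2
    have htm : m ≤ t := B.min'_le t ht
    refine Finset.mem_Ico.2 ⟨htm, lt_of_not_ge fun hcon => (not_or.1 ht'.2).1 ?_⟩
    -- At the first undecided index `y * ξ m` exceeds `z / K ^ 2`; four steps multiply it by `K ^
    -- 4`, which lifts it past `K ^ 2 * z`.
    have e1 := mul_le_mul_of_nonneg_left (pow_mul_le_of_growth hK hξ hm1.1 4 (by omega)) hy
    have e2 := mul_le_mul_of_nonneg_left (le_of_growth hK h1 hξ (by omega) hcon htn) hy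
    have e3 := mul_le_mul_of_nonneg_left (not_le.1 hm2.2).le (sq_nonneg K)
    have e4 : K ^ 2 * (K ^ 2 * (y * ξ m)) = y * (K ^ 4 * ξ m) := by ring
    linarith
  exact (Finset.card_le_card hsub).trans (by simp)

end growth

/-! ### Growth along the three axes -/

section stretched

variable {n : ℕ} {x : ℕ → ℕ → ℝ}

namespace IsStretched

lemma growth_one (h : IsStretched 3 n x) : ∀ j, 1 ≤ j → j < n → 8 * x 1 j ≤ x 1 (j + 1) := by
  intro j hj hjn
  have := h.growth 1 j le_rfl (by norm_num) hj hjn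
  norm_num [growthFactor] at this
  exact this

lemma growth_two (h : IsStretched 3 n x) :
    ∀ j, 1 ≤ j → j < n → 8 * x 1 n * x 2 j ≤ x 2 (j + 1) := by
  intro j hj hjn
  have := h.growth 2 j (by norm_num) (by norm_num) hj hjn
  norm_num [growthFactor] at this
  exact this

lemma growth_three (h : IsStretched 3 n x) :
    ∀ j, 1 ≤ j → j < n → 8 * x 2 n * x 3 j ≤ x 3 (j + 1) := by
  intro j hj hjn
  have := h.growth 3 j (by norm_num) (by norm_num) hj hjn
  norm_num [growthFactor] at this
  exact this

lemma one_le_one (h : IsStretched 3 n x) {j : ℕ} (hj : 1 ≤ j) (hjn : j ≤ n) : 1 ≤ x 1 j :=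
  one_le_of_growth (by norm_num) (h.first 1 le_rfl (by norm_num)) h.growth_one hj hjn

lemma one_le_factor_two (h : IsStretched 3 n x) (hn : 1 ≤ n) : 1 ≤ 8 * x 1 n := by
  linarith [h.one_le_one hn le_rfl]

lemma one_le_two (h : IsStretched 3 n x) {j : ℕ} (hj : 1 ≤ j) (hjn : j ≤ n) : 1 ≤ x 2 j :=
  one_le_of_growth (h.one_le_factor_two (hj.trans hjn)) (h.first 2 (by norm_num) (by norm_num))
    h.growth_two hj hjn

lemma one_le_factor_three (h : IsStretched 3 n x) (hn : 1 ≤ n) : 1 ≤ 8 * x 2 n := by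
  linarith [h.one_le_two hn le_rfl]

lemma one_le_three (h : IsStretched 3 n x) {j : ℕ} (hj : 1 ≤ j) (hjn : j ≤ n) : 1 ≤ x 3 j :=
  one_le_of_growth (h.one_le_factor_three (hj.trans hjn))
    (h.first 3 (by norm_num) (by norm_num)) h.growth_three hj hjn

lemma eight_mul_le (h : IsStretched 3 n x) {s t : ℕ} (hs : 1 ≤ s) (hst : s < t) (ht : t ≤ n) :
    8 * x 1 s ≤ x 1 t :=
  mul_le_of_growth (by norm_num) (h.first 1 le_rfl (by norm_num)) h.growth_one hs hst ht

lemma factor_two_mul_le (h : IsStretched 3 n x) {s t : ℕ} (hs : 1 ≤ s) (hst : s < t)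
    (ht : t ≤ n) : 8 * x 1 n * x 2 s ≤ x 2 t :=
  mul_le_of_growth (h.one_le_factor_two (by omega)) (h.first 2 (by norm_num) (by norm_num))
    h.growth_two hs hst ht

lemma factor_three_mul_le (h : IsStretched 3 n x) {s t : ℕ} (hs : 1 ≤ s) (hst : s < t)
    (ht : t ≤ n) : 8 * x 2 n * x 3 s ≤ x 3 t :=
  mul_le_of_growth (h.one_le_factor_three (by omega)) (h.first 3 (by norm_num) (by norm_num))
    h.growth_three hs hst ht

lemma mono_one (h : IsStretched 3 n x) {s t : ℕ} (hs : 1 ≤ s) (hst : s ≤ t) (ht : t ≤ n) :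
    x 1 s ≤ x 1 t :=
  le_of_growth (by norm_num) (h.first 1 le_rfl (by norm_num)) h.growth_one hs hst ht

lemma mono_two (h : IsStretched 3 n x) {s t : ℕ} (hs : 1 ≤ s) (hst : s ≤ t) (ht : t ≤ n) :
    x 2 s ≤ x 2 t :=
  le_of_growth (h.one_le_factor_two (by omega)) (h.first 2 (by norm_num) (by norm_num))
    h.growth_two hs hst ht

lemma mono_three (h : IsStretched 3 n x) {s t : ℕ} (hs : 1 ≤ s) (hst : s ≤ t) (ht : t ≤ n) :
    x 3 s ≤ x 3 t :=
  le_of_growth (h.one_le_factor_three (by omega)) (h.first 3 (by norm_num) (by norm_num))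
    h.growth_three hs hst ht

end IsStretched

end stretched

/-! ### The dominant term of the form -/

/-- A sum of a term `Q * m` and a remainder has the sign of `Q` if the term dominates. -/
lemma mul_add_pos_of_dominates {Q m z R : ℝ} (hz : 0 < |Q| * z) (hm : 7 / 8 * z ≤ m)
    (hR : |R| ≤ 5 / 8 * (|Q| * z)) : 0 < Q * (Q * m + R) := by
  have hQ : 0 < |Q| := by
    rcases (abs_nonneg Q).lt_or_eq with h | h
    · exact h
    · simp [← h] at hz
  have e1 : -(|Q| * |R|) ≤ Q * R := by rw [← abs_mul]; exact neg_abs_le _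
  have e2 : Q * (Q * m + R) = |Q| * (|Q| * m) + Q * R := by
    rw [← mul_assoc |Q|, abs_mul_abs_self]; ring
  have e3 := mul_le_mul_of_nonneg_left hR hQ.le
  have e4 := mul_le_mul_of_nonneg_left (mul_le_mul_of_nonneg_left hm hQ.le) hQ.le
  nlinarith [mul_pos hQ hz]

/-- The sign of a sum of six terms one of which dominates each of the five others. -/
lemma sum_six_sign {Q m z : Fin 6 → ℝ} (k : Fin 6) (hm : ∀ i, 7 / 8 * z i ≤ m i)
    (hm0 : ∀ i, 0 ≤ m i) (hmz : ∀ i, m i ≤ z i) (hz : 0 < |Q k| * z k)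
    (hk : ∀ i ≠ k, 8 * (|Q i| * z i) ≤ |Q k| * z k) : 0 < Q k * ∑ i, Q i * m i := by
  rw [← Finset.add_sum_erase _ _ (Finset.mem_univ k)]
  refine mul_add_pos_of_dominates hz (hm k) ?_
  calc |∑ i ∈ Finset.univ.erase k, Q i * m i|
      ≤ ∑ i ∈ Finset.univ.erase k, |Q i * m i| := Finset.abs_sum_le_sum_abs _ _
    _ ≤ ∑ i ∈ Finset.univ.erase k, 1 / 8 * (|Q k| * z k) := by
        refine Finset.sum_le_sum fun i hi => ?_
        have h1 := hk i (Finset.ne_of_mem_erase hi)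
        have h2 := mul_le_mul_of_nonneg_left (hmz i) (abs_nonneg (Q i))
        rw [abs_mul, abs_of_nonneg (hm0 i)]
        linarith
    _ = _ := by simp; ring

/-- The minors of the rows `(1, x_{1,s}, x_{2,s}, x_{3,s})` and `(1, x_{1,t}, x_{2,t}, x_{3,t})`. -/
def minors (x : ℕ → ℕ → ℝ) (s t : ℕ) : Fin 6 → ℝ :=
  ![x 1 t - x 1 s, x 2 t - x 2 s, x 3 t - x 3 s, x 1 s * x 2 t - x 2 s * x 1 t,
    x 1 s * x 3 t - x 3 s * x 1 t, x 2 s * x 3 t - x 3 s * x 2 t]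

/-- The diagonal terms of the minors `minors x s t`. -/
def diagTerms (x : ℕ → ℕ → ℝ) (s t : ℕ) : Fin 6 → ℝ :=
  ![x 1 t, x 2 t, x 3 t, x 1 s * x 2 t, x 1 s * x 3 t, x 2 s * x 3 t]

/-- The axis along which each of the five thresholds is taken. -/
def thresholdAxis : Fin 5 → ℕ := ![3, 2, 1, 2, 1]

/-- The coefficient of the coordinate in each of the five thresholds, where `P` lists the Plücker
coordinates `01, 02, 03, 12, 13, 23` of a line. -/
def thresholdCoeff (P : Fin 6 → ℝ) : Fin 5 → ℝ :=
  ![max (max |P 2| |P 4|) |P 5|, max |P 1| |P 3|, |P 3|, |P 5|, |P 4|]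

/-- The constant to which each of the five thresholds compares. -/
def thresholdConst (P : Fin 6 → ℝ) : Fin 5 → ℝ :=
  ![max |P 0| (max |P 1| |P 3|), |P 0|, |P 1|, max |P 2| |P 4|, |P 2|]

/-- The growth factor of the axis of each of the five thresholds. -/
def thresholdFactor (n : ℕ) (x : ℕ → ℕ → ℝ) : Fin 5 → ℝ :=
  ![8 * x 2 n, 8 * x 1 n, 8, 8 * x 1 n, 8]

/-- The index `t` is clearly beyond the `k`-th threshold. -/
def Passes (P : Fin 6 → ℝ) (n : ℕ) (x : ℕ → ℕ → ℝ) (k : Fin 5) (t : ℕ) : Prop :=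
  thresholdFactor n x k ^ 2 * thresholdConst P k ≤ thresholdCoeff P k * x (thresholdAxis k) t

/-- The index `t` is clearly beyond or clearly before the `k`-th threshold. -/
def Decided (P : Fin 6 → ℝ) (n : ℕ) (x : ℕ → ℕ → ℝ) (k : Fin 5) (t : ℕ) : Prop :=
  Passes P n x k t ∨
    thresholdFactor n x k ^ 2 * (thresholdCoeff P k * x (thresholdAxis k) t) ≤ thresholdConst P k

open Classical in
/-- The index of the dominant term of `∑ i, P i * minors x s t i` for `s < t`. -/
noncomputable def leadIndex (π : Fin 5 → ℕ → Prop) (s t : ℕ) : Fin 6 :=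
  if π 0 t then if π 3 s then 5 else if π 4 s then 4 else 2
  else if π 1 t then if π 2 s then 3 else 1
  else 0

section

variable {n : ℕ} {x : ℕ → ℕ → ℝ}

/-- The growth factor of an axis is 8 times the largest coordinate of the preceding axis, so the
off-diagonal product of each minor is at most an eighth of the diagonal one. -/
lemma minors_bounds (h : IsStretched 3 n x) {s t : ℕ} (hs : 1 ≤ s) (hst : s < t) (ht : t ≤ n)
    (i : Fin 6) : 7 / 8 * diagTerms x s t i ≤ minors x s t i ∧ 0 ≤ diagTerms x s t i ∧
      minors x s t i ≤ diagTerms x s t i := by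
  have a1 := h.one_le_one hs (by omega)
  have a2 := h.one_le_two hs (by omega)
  have a3 := h.one_le_three hs (by omega)
  have b1 := h.one_le_one (by omega) ht
  have b2 := h.one_le_two (by omega) ht
  have b3 := h.one_le_three (by omega) ht
  have u1 := h.mono_one (by omega) ht le_rfl
  have u2 := h.mono_two (by omega) ht le_rfl
  have g1 := h.eight_mul_le hs hst ht
  have g2 := h.factor_two_mul_le hs hst ht
  have g3 := h.factor_three_mul_le hs hst ht
  have c12 : 8 * (x 1 t * x 2 s) ≤ x 2 t := by nlinarith
  have c23 : 8 * (x 2 t * x 3 s) ≤ x 3 t := by nlinarith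
  have u12 : x 1 t ≤ x 2 t := by nlinarith
  have c13 : 8 * (x 1 t * x 3 s) ≤ x 3 t := by nlinarith
  have p12 : x 2 t ≤ x 1 s * x 2 t := by nlinarith
  have p13 : x 3 t ≤ x 1 s * x 3 t := by nlinarith
  have p23 : x 3 t ≤ x 2 s * x 3 t := by nlinarith
  have q12 : 0 ≤ x 2 s * x 1 t := by positivity
  have q13 : 0 ≤ x 3 s * x 1 t := by positivity
  have q23 : 0 ≤ x 3 s * x 2 t := by positivity
  have r2 : 8 * x 2 s ≤ x 2 t := by nlinarith
  have r3 : 8 * x 3 s ≤ x 3 t := by nlinarith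
  fin_cases i <;> simp [minors, diagTerms] <;> refine ⟨?_, ?_, ?_⟩ <;> linarith

/-- A term that passes a threshold exceeds the terms of the other side. -/
lemma mul_le_of_passed {X p q u v M : ℝ} (hX : 1 ≤ X) (hp : 0 ≤ p) (hpq : p ≤ q) (hu : 0 ≤ u)
    (huX : u ≤ X) (hv : 0 ≤ v) (hvX : v ≤ X) (h : (8 * X) ^ 2 * q ≤ M) :
    8 * (p * (u * v)) ≤ M := by
  -- The margin `(8 * X) ^ 2` pays for both coordinates `u` and `v`, and its factor 64 covers the
  -- required 8.
  have h1 : u * v ≤ X * X := mul_le_mul huX hvX hv (by linarith)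
  have h2 : p * (u * v) ≤ q * (X * X) := mul_le_mul hpq h1 (mul_nonneg hu hv) (hp.trans hpq)
  have h3 : 0 ≤ q * (X * X) := mul_nonneg (hp.trans hpq) (by positivity)
  nlinarith

lemma le_of_passed {X p q M : ℝ} (hX : 1 ≤ X) (hp : 0 ≤ p) (hpq : p ≤ q)
    (h : (8 * X) ^ 2 * q ≤ M) : 8 * p ≤ M := by
  simpa using mul_le_of_passed hX hp hpq zero_le_one hX zero_le_one hX h

-- The comparison runs from the fastest axis down. Threshold 0 tests whether the terms with `x 3 t`
-- win; if so, thresholds 3 and 4 choose among them by `x 2 s` and `x 1 s`. Otherwise threshold 1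
-- tests the terms with `x 2 t` against that with `x 1 t`, and threshold 2 chooses by `x 1 s`. The
-- margins make the winner at least 8 times each of the others, so these total at most `5 / 8` of
-- it, less than the `7 / 8` kept by its minor.
set_option maxHeartbeats 2000000 in
lemma sign_eq_lead (h : IsStretched 3 n x) {P : Fin 6 → ℝ} (hP : ∃ i, P i ≠ 0) {s t : ℕ}
    (hs : 1 ≤ s) (hst : s < t) (ht : t ≤ n) (hds : ∀ k, Decided P n x k s)
    (hdt : ∀ k, Decided P n x k t) :
    0 < P (leadIndex (Passes P n x) s t) * ∑ i, P i * minors x s t i := by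
  have hb := minors_bounds h hs hst ht
  have a1 := h.one_le_one hs (by omega)
  have a2 := h.one_le_two hs (by omega)
  have b1 := h.one_le_one (by omega) ht
  have b2 := h.one_le_two (by omega) ht
  have b3 := h.one_le_three (by omega) ht
  have u1 := h.mono_one (by omega) ht le_rfl
  have u2 := h.mono_two (by omega) ht le_rfl
  have v1 := h.mono_one hs (by omega) le_rfl
  have v2 := h.mono_two hs (by omega) le_rfl
  have g2 := h.factor_two_mul_le hs hst ht
  have u12 : x 1 n ≤ x 2 n := by nlinarith
  have hk : ∀ k : Fin 6, 0 < |P k| * diagTerms x s t k →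
      (∀ i, i ≠ k → 8 * (|P i| * diagTerms x s t i) ≤ |P k| * diagTerms x s t k) →
      0 < P k * ∑ i, P i * minors x s t i := fun k hm h3 =>
    sum_six_sign k (fun i => (hb i).1) (fun i => by linarith [hb i]) (fun i => (hb i).2.2) hm h3
  have hPn : ∀ i, 0 ≤ |P i| := fun i => abs_nonneg _
  obtain ⟨a, ha⟩ : ∃ a, a = |P 0| := ⟨_, rfl⟩
  obtain ⟨b, hb'⟩ : ∃ a, a = |P 1| := ⟨_, rfl⟩
  obtain ⟨c, hc⟩ : ∃ a, a = |P 2| := ⟨_, rfl⟩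
  obtain ⟨d, hd⟩ : ∃ a, a = |P 3| := ⟨_, rfl⟩
  obtain ⟨e, he⟩ : ∃ a, a = |P 4| := ⟨_, rfl⟩
  obtain ⟨f, hf⟩ : ∃ a, a = |P 5| := ⟨_, rfl⟩
  have a0 : 0 ≤ a := ha ▸ hPn 0
  have b0 : 0 ≤ b := hb' ▸ hPn 1
  have c0 : 0 ≤ c := hc ▸ hPn 2
  have d0 : 0 ≤ d := hd ▸ hPn 3
  have e0 : 0 ≤ e := he ▸ hPn 4
  have f0 : 0 ≤ f := hf ▸ hPn 5
  have hX1 : 1 ≤ x 1 n := b1.trans u1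
  have hX2 : 1 ≤ x 2 n := b2.trans u2
  have hP' : ¬(a = 0 ∧ b = 0 ∧ c = 0 ∧ d = 0 ∧ e = 0 ∧ f = 0) := by
    rintro ⟨h0, h1, h2, h3, h4, h5⟩
    obtain ⟨i, hi⟩ := hP
    apply hi
    rw [← abs_eq_zero]
    fin_cases i
    exacts [ha ▸ h0, hb' ▸ h1, hc ▸ h2, hd ▸ h3, he ▸ h4, hf ▸ h5]
  have dt0 := hdt 0
  have dt1 := hdt 1
  have ds2 := hds 2
  have ds3 := hds 3
  have ds4 := hds 4
  unfold leadIndex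
  simp only [Decided, Passes, thresholdFactor, thresholdConst, thresholdCoeff, thresholdAxis,
    Matrix.cons_val, ← ha, ← hb', ← hc, ← hd, ← he, ← hf] at dt0 dt1 ds2 ds3 ds4 ⊢
  have hce : 0 ≤ max c e := le_max_of_le_left c0
  have hbd : 0 ≤ max b d := le_max_of_le_left b0
  have heA : e ≤ e * x 1 s := le_mul_of_one_le_right e0 a1
  have hdA : d ≤ d * x 1 s := le_mul_of_one_le_right d0 a1
  have hfA : f ≤ f * x 2 s := le_mul_of_one_le_right f0 a2
  have hK1 : 1 ≤ (8 * x 1 n) ^ 2 := one_le_pow₀ (by linarith)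
  have hK2 : 1 ≤ (8 * x 2 n) ^ 2 := one_le_pow₀ (by linarith)
  have B3 : 0 ≤ x 3 t := by linarith
  by_cases p0 : (8 * x 2 n) ^ 2 * max a (max b d) ≤ max (max c e) f * x 3 t
  · rw [if_pos p0]
    have l0 : 8 * (a * x 1 t) ≤ max (max c e) f * x 3 t := by
      simpa using mul_le_of_passed hX2 a0 (le_max_left _ _) (by linarith) (u1.trans u12)
        zero_le_one hX2 p0
    have l1 : 8 * (b * x 2 t) ≤ max (max c e) f * x 3 t := by
      simpa using mul_le_of_passed hX2 b0 ((le_max_left b d).trans (le_max_right _ _))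
        (by linarith) u2 zero_le_one hX2 p0
    have l3 : 8 * (d * (x 1 s * x 2 t)) ≤ max (max c e) f * x 3 t :=
      mul_le_of_passed hX2 d0 ((le_max_right b d).trans (le_max_right _ _))
        (by linarith) (v1.trans u12) (by linarith) u2 p0
    -- Passing is a weak inequality and holds also as `0 ≤ 0`; that case would make all Plücker
    -- coordinates vanish.
    have hm3 : 0 < max (max c e) f := by
      by_contra hcon
      have hm3 : max (max c e) f = 0 := le_antisymm (not_lt.1 hcon) (le_max_of_le_right f0)
      rw [hm3, zero_mul] at l0 l1 l3
      have hc0 : c = 0 := le_antisymm (by rw [← hm3]; simp) c0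
      have he0 : e = 0 := le_antisymm (by rw [← hm3]; simp) e0
      have hf0 : f = 0 := le_antisymm (by rw [← hm3]; simp) f0
      have hdAB : d ≤ d * (x 1 s * x 2 t) :=
        le_mul_of_one_le_right d0 (one_le_mul_of_one_le_of_one_le a1 b2)
      have haB : a ≤ a * x 1 t := le_mul_of_one_le_right a0 b1
      have hbB : b ≤ b * x 2 t := le_mul_of_one_le_right b0 b2
      exact hP' ⟨by linarith, by linarith, hc0, by linarith, he0, hf0⟩
    by_cases p3 : (8 * x 1 n) ^ 2 * max c e ≤ f * x 2 s
    · rw [if_pos p3]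
      have hmax : max (max c e) f ≤ f * x 2 s :=
        max_le ((le_mul_of_one_le_left hce hK1).trans p3) hfA
      have l2 : 8 * c ≤ f * x 2 s := le_of_passed hX1 c0 (le_max_left _ _) p3
      have l4 : 8 * (e * x 1 s) ≤ f * x 2 s := by
        simpa using mul_le_of_passed hX1 e0 (le_max_right _ _) (by linarith) v1
          zero_le_one hX1 p3
      have hB := mul_le_mul_of_nonneg_right hmax B3
      have hpos := mul_pos hm3 (by linarith : 0 < x 3 t)
      have t2 := mul_le_mul_of_nonneg_right l2 B3
      have t4 := mul_le_mul_of_nonneg_right l4 B3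
      apply hk 5
      · simp only [diagTerms, Matrix.cons_val, ← hf]
        linarith
      · intro i hi
        fin_cases i <;> simp [diagTerms, ← ha, ← hb', ← hc, ← hd, ← he, ← hf] at hi ⊢ <;>
          linarith
    · rw [if_neg p3]
      replace ds3 := ds3.resolve_left p3
      have hce0 : max c e ≤ max c (e * x 1 s) := max_le_max le_rfl heA
      have hmax : max (max c e) f ≤ max c (e * x 1 s) := by
        refine max_le hce0 (hfA.trans (le_trans ?_ hce0))
        exact (le_mul_of_one_le_left (by positivity) hK1).trans ds3
      have l5 : 8 * (f * x 2 s) ≤ max c (e * x 1 s) :=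
        (le_of_passed hX1 (by positivity) le_rfl ds3).trans hce0
      by_cases p4 : 8 ^ 2 * c ≤ e * x 1 s
      · rw [if_pos p4]
        rw [max_eq_right (by linarith : c ≤ e * x 1 s)] at hmax l5
        have hB := mul_le_mul_of_nonneg_right hmax B3
        have hpos := mul_pos hm3 (by linarith : 0 < x 3 t)
        have t2 : 8 * c * x 3 t ≤ e * x 1 s * x 3 t :=
          mul_le_mul_of_nonneg_right (by linarith) B3
        have t5 := mul_le_mul_of_nonneg_right l5 B3
        apply hk 4
        · simp only [diagTerms, Matrix.cons_val, ← he]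
          linarith
        · intro i hi
          fin_cases i <;> simp [diagTerms, ← ha, ← hb', ← hc, ← hd, ← he, ← hf] at hi ⊢ <;>
            linarith
      · rw [if_neg p4]
        replace ds4 := ds4.resolve_left p4
        have : 0 ≤ e * x 1 s := by positivity
        rw [max_eq_left (by linarith : e * x 1 s ≤ c)] at hmax l5
        have hB := mul_le_mul_of_nonneg_right hmax B3
        have hpos := mul_pos hm3 (by linarith : 0 < x 3 t)
        have t4 : 8 * (e * x 1 s) * x 3 t ≤ c * x 3 t :=
          mul_le_mul_of_nonneg_right (by linarith) B3
        have t5 := mul_le_mul_of_nonneg_right l5 B3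
        apply hk 2
        · simp only [diagTerms, Matrix.cons_val, ← hc]
          linarith
        · intro i hi
          fin_cases i <;> simp [diagTerms, ← ha, ← hb', ← hc, ← hd, ← he, ← hf] at hi ⊢ <;>
            linarith
  · rw [if_neg p0]
    replace dt0 := dt0.resolve_left p0
    have hm : 0 < max a (max b d) := by
      by_contra hcon
      have hm0 : max a (max b d) = 0 := le_antisymm (not_lt.1 hcon) (le_max_of_le_left a0)
      rw [hm0, mul_zero] at p0
      exact p0 (mul_nonneg (le_max_of_le_right f0) (by linarith))
    have l2 : 8 * (c * x 3 t) ≤ max a (max b d) :=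
      le_of_passed hX2 (by positivity) (mul_le_mul_of_nonneg_right
        ((le_max_left c e).trans (le_max_left _ _)) B3) dt0
    have l4 : 8 * (e * x 3 t * (x 1 s * 1)) ≤ max a (max b d) :=
      mul_le_of_passed hX2 (by positivity) (mul_le_mul_of_nonneg_right
        ((le_max_right c e).trans (le_max_left _ _)) B3) (by linarith) (v1.trans u12)
        zero_le_one hX2 dt0
    have l5 : 8 * (f * x 3 t * (x 2 s * 1)) ≤ max a (max b d) :=
      mul_le_of_passed hX2 (by positivity) (mul_le_mul_of_nonneg_right
        (le_max_right _ _) B3) (by linarith) v2 zero_le_one hX2 dt0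
    have hB2 : max b d ≤ max b d * x 2 t := le_mul_of_one_le_right hbd b2
    by_cases p1 : (8 * x 1 n) ^ 2 * a ≤ max b d * x 2 t
    · rw [if_pos p1]
      have l0 : 8 * (a * x 1 t) ≤ max b d * x 2 t := by
        simpa using mul_le_of_passed hX1 a0 le_rfl (by linarith) u1 zero_le_one hX1 p1
      have hmax : max a (max b d) ≤ max b d * x 2 t :=
        max_le ((le_mul_of_one_le_left a0 hK1).trans p1) hB2
      by_cases p2 : 8 ^ 2 * b ≤ d * x 1 s
      · rw [if_pos p2]
        have hbdA : max b d ≤ d * x 1 s := max_le (by linarith) hdA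
        have hB := mul_le_mul_of_nonneg_right hbdA (by linarith : 0 ≤ x 2 t)
        have t1 : 8 * b * x 2 t ≤ d * x 1 s * x 2 t :=
          mul_le_mul_of_nonneg_right (by linarith) (by linarith)
        apply hk 3
        · simp only [diagTerms, Matrix.cons_val, ← hd]
          linarith
        · intro i hi
          fin_cases i <;> simp [diagTerms, ← ha, ← hb', ← hc, ← hd, ← he, ← hf] at hi ⊢ <;>
            linarith
      · rw [if_neg p2]
        replace ds2 := ds2.resolve_left p2
        have hbdA : max b d ≤ b := max_le le_rfl (by linarith)
        have hB := mul_le_mul_of_nonneg_right hbdA (by linarith : 0 ≤ x 2 t)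
        have t3 : 8 * (d * x 1 s) * x 2 t ≤ b * x 2 t :=
          mul_le_mul_of_nonneg_right (by linarith) (by linarith)
        apply hk 1
        · simp only [diagTerms, Matrix.cons_val, ← hb']
          linarith
        · intro i hi
          fin_cases i <;> simp [diagTerms, ← ha, ← hb', ← hc, ← hd, ← he, ← hf] at hi ⊢ <;>
            linarith
    · rw [if_neg p1]
      replace dt1 := dt1.resolve_left p1
      have B2 : 0 ≤ x 2 t := by linarith
      have l1 : 8 * (b * x 2 t) ≤ a :=
        le_of_passed hX1 (by positivity) (mul_le_mul_of_nonneg_right (le_max_left _ _) B2) dt1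
      have l3 : 8 * (d * x 2 t * (x 1 s * 1)) ≤ a :=
        mul_le_of_passed hX1 (by positivity) (mul_le_mul_of_nonneg_right (le_max_right _ _) B2)
          (by linarith) v1 zero_le_one hX1 dt1
      have hmax : max a (max b d) ≤ a := by
        refine max_le le_rfl (hB2.trans ?_)
        exact (le_mul_of_one_le_left (by positivity) hK1).trans dt1
      have haB : a ≤ a * x 1 t := le_mul_of_one_le_right a0 b1
      apply hk 0
      · simp only [diagTerms, Matrix.cons_val, ← ha]
        linarith
      · intro i hi
        fin_cases i <;> simp [diagTerms, ← ha, ← hb', ← hc, ← hd, ← he, ← hf] at hi ⊢ <;>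
          linarith

end

/-! ### Undecided indices and the redundant threshold -/

section

variable {n : ℕ} {x : ℕ → ℕ → ℝ}

lemma thresholdCoeff_nonneg (P : Fin 6 → ℝ) (k : Fin 5) : 0 ≤ thresholdCoeff P k := by
  fin_cases k <;> simp [thresholdCoeff]

lemma thresholdAxis_growth (h : IsStretched 3 n x) (k : Fin 5) :
    ∀ j, 1 ≤ j → j < n →
      thresholdFactor n x k * x (thresholdAxis k) j ≤ x (thresholdAxis k) (j + 1) := by
  fin_cases k
  exacts [h.growth_three, h.growth_two, h.growth_one, h.growth_two, h.growth_one]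

lemma one_le_thresholdFactor (h : IsStretched 3 n x) (hn : 1 ≤ n) (k : Fin 5) :
    1 ≤ thresholdFactor n x k := by
  fin_cases k
  exacts [h.one_le_factor_three hn, h.one_le_factor_two hn, by norm_num [thresholdFactor],
    h.one_le_factor_two hn, by norm_num [thresholdFactor]]

lemma thresholdAxis_first (h : IsStretched 3 n x) (k : Fin 5) : x (thresholdAxis k) 1 = 1 := by
  fin_cases k <;> exact h.first _ (by norm_num [thresholdAxis]) (by norm_num [thresholdAxis])

lemma Passes.mono (h : IsStretched 3 n x) {P : Fin 6 → ℝ} {k : Fin 5} {s t : ℕ}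
    (hp : Passes P n x k s) (hs : 1 ≤ s) (hst : s ≤ t) (ht : t ≤ n) : Passes P n x k t :=
  hp.trans (mul_le_mul_of_nonneg_left (le_of_growth (one_le_thresholdFactor h (by omega) k)
    (thresholdAxis_first h k) (thresholdAxis_growth h k) hs hst ht) (thresholdCoeff_nonneg P k))

open Classical in
/-- The indices that are clearly on one side of each threshold. -/
noncomputable def decidedIndices (P : Fin 6 → ℝ) (n : ℕ) (x : ℕ → ℕ → ℝ) : Finset ℕ :=
  (Finset.Icc 1 n).filter fun t => ∀ k, Decided P n x k t

lemma mem_decidedIndices {P : Fin 6 → ℝ} {t : ℕ} :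
    t ∈ decidedIndices P n x ↔ (1 ≤ t ∧ t ≤ n) ∧ ∀ k, Decided P n x k t := by
  simp [decidedIndices]

lemma card_sdiff_decidedIndices_le (h : IsStretched 3 n x) (P : Fin 6 → ℝ) :
    (Finset.Icc 1 n \ decidedIndices P n x).card ≤ 20 := by
  classical
  rcases n.eq_zero_or_pos with rfl | hn
  · simp
  have hsub : Finset.Icc 1 n \ decidedIndices P n x ⊆
      Finset.univ.biUnion fun k => (Finset.Icc 1 n).filter fun t => ¬Decided P n x k t := by
    intro t ht
    simp only [Finset.mem_sdiff, mem_decidedIndices, Finset.mem_Icc, not_and, not_forall] at ht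
    obtain ⟨k, hk⟩ := ht.2 ht.1
    simp only [Finset.mem_biUnion, Finset.mem_filter, Finset.mem_Icc]
    exact ⟨k, Finset.mem_univ _, ht.1, hk⟩
  refine (Finset.card_le_card hsub).trans (Finset.card_biUnion_le.trans ?_)
  calc _ ≤ ∑ _k : Fin 5, 4 := Finset.sum_le_sum fun k _ => by
        refine (Finset.card_le_card fun t ht => ?_).trans
          (card_undecided_le (one_le_thresholdFactor h hn k) (thresholdCoeff_nonneg P k)
            (thresholdAxis_first h k) (thresholdAxis_growth h k) (z := thresholdConst P k))
        rw [Finset.mem_filter] at ht ⊢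
        exact ht
    _ = 20 := by simp

/-- By the Plücker relation, one of the five thresholds is determined by the others. -/
lemma exists_redundant_threshold (h : IsStretched 3 n x) {P : Fin 6 → ℝ}
    (hP : P 0 * P 5 - P 1 * P 4 + P 2 * P 3 = 0) :
    ∃ k₀ : Fin 5, ∀ s ∈ decidedIndices P n x, ∀ t ∈ decidedIndices P n x,
      (∀ k ≠ k₀, (Passes P n x k s ↔ Passes P n x k t)) →
        (Passes P n x k₀ s ↔ Passes P n x k₀ t) := by
  -- A threshold that is not crossed within the decided indices is redundant, so thresholds 2 and 4
  -- may be assumed crossed.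
  by_cases c2 : ∀ s ∈ decidedIndices P n x, ∀ t ∈ decidedIndices P n x,
      Passes P n x 2 s → Passes P n x 2 t
  · exact ⟨2, fun s hs t ht _ => ⟨c2 s hs t ht, c2 t ht s hs⟩⟩
  by_cases c4 : ∀ s ∈ decidedIndices P n x, ∀ t ∈ decidedIndices P n x,
      Passes P n x 4 s → Passes P n x 4 t
  · exact ⟨4, fun s hs t ht _ => ⟨c4 s hs t ht, c4 t ht s hs⟩⟩
  push Not at c2 c4
  obtain ⟨s, hs, t, ht, ps, pt⟩ := c2
  obtain ⟨s', hs', t', ht', ps', pt'⟩ := c4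
  rw [mem_decidedIndices] at hs ht hs' ht'
  have qt := (ht.2 2).resolve_left pt
  have qt' := (ht'.2 4).resolve_left pt'
  obtain ⟨a, ha⟩ : ∃ a, a = |P 0| := ⟨_, rfl⟩
  obtain ⟨b, hb⟩ : ∃ a, a = |P 1| := ⟨_, rfl⟩
  obtain ⟨c, hc⟩ : ∃ a, a = |P 2| := ⟨_, rfl⟩
  obtain ⟨d, hd⟩ : ∃ a, a = |P 3| := ⟨_, rfl⟩
  obtain ⟨e, he⟩ : ∃ a, a = |P 4| := ⟨_, rfl⟩
  obtain ⟨f, hf⟩ : ∃ a, a = |P 5| := ⟨_, rfl⟩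
  have a0 : 0 ≤ a := ha ▸ abs_nonneg _
  have b0 : 0 ≤ b := hb ▸ abs_nonneg _
  have c0 : 0 ≤ c := hc ▸ abs_nonneg _
  have d0 : 0 ≤ d := hd ▸ abs_nonneg _
  have e0 : 0 ≤ e := he ▸ abs_nonneg _
  have f0 : 0 ≤ f := hf ▸ abs_nonneg _
  have haf : a * f = |P 0 * P 5| := by rw [abs_mul, ha, hf]
  have hbe : b * e = |P 1 * P 4| := by rw [abs_mul, hb, he]
  have hcd : c * d = |P 2 * P 3| := by rw [abs_mul, hc, hd]
  -- By the Plücker relation none of the products `a * f`, `b * e`, `c * d` exceeds the sum of the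
  -- other two.
  have r1 : b * e ≤ a * f + c * d := by
    rw [haf, hbe, hcd, show P 1 * P 4 = P 0 * P 5 + P 2 * P 3 by linarith]
    exact abs_add_le _ _
  have r2 : c * d ≤ b * e + a * f := by
    rw [haf, hbe, hcd, show P 2 * P 3 = P 1 * P 4 - P 0 * P 5 by linarith]
    exact abs_sub _ _
  have r3 : a * f ≤ b * e + c * d := by
    rw [haf, hbe, hcd, show P 0 * P 5 = P 1 * P 4 - P 2 * P 3 by linarith]
    exact abs_sub _ _
  simp only [Passes, thresholdFactor, thresholdConst, thresholdCoeff, thresholdAxis,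
    Matrix.cons_val, ← ha, ← hb, ← hc, ← hd, ← he, ← hf] at ps pt qt ps' pt' qt'
  have x1s := h.one_le_one hs.1.1 hs.1.2
  have x1t := h.one_le_one ht.1.1 ht.1.2
  have x1s' := h.one_le_one hs'.1.1 hs'.1.2
  have x1t' := h.one_le_one ht'.1.1 ht'.1.2
  have hX := x1s.trans (h.mono_one hs.1.1 hs.1.2 le_rfl)
  have ms := mul_le_mul_of_nonneg_left (h.mono_one hs.1.1 hs.1.2 le_rfl) d0
  have ms' := mul_le_mul_of_nonneg_left (h.mono_one hs'.1.1 hs'.1.2 le_rfl) e0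
  have hdt := le_mul_of_one_le_right d0 x1t
  have het := le_mul_of_one_le_right e0 x1t'
  -- Crossing places `b / d` and `c / e` within the range from 1 to `x 1 n`.
  have hdb : d ≤ b := by linarith
  have hec : e ≤ c := by linarith
  have hbd : b ≤ d * x 1 n := by linarith
  have hce : c ≤ e * x 1 n := by linarith
  have hb0 : 0 < b := by linarith
  have hc0 : 0 < c := by linarith
  have hd0 : 0 < d :=
    (pos_iff_pos_of_mul_pos (by linarith : 0 < d * x 1 s)).2 (by linarith)
  have he0 : 0 < e :=
    (pos_iff_pos_of_mul_pos (by linarith : 0 < e * x 1 s')).2 (by linarith)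
  -- Here `b * e` and `c * d` agree up to a factor 2, hence so do the critical values `b / d` and `c
  -- / e` of `x 1`. The margins absorb this factor, and thresholds 2 and 4 coincide on decided
  -- indices.
  by_cases hA : a * f ≤ b * e ∧ a * f ≤ c * d
  · have key : ∀ u ∈ decidedIndices P n x, Passes P n x 2 u ↔ Passes P n x 4 u := by
      intro u hu
      rw [mem_decidedIndices] at hu
      have d2 := hu.2 2
      have d4 := hu.2 4
      have x1u := h.one_le_one hu.1.1 hu.1.2
      simp only [Decided, Passes, thresholdFactor, thresholdConst, thresholdCoeff, thresholdAxis,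
        Matrix.cons_val, ← ha, ← hb, ← hc, ← hd, ← he, ← hf] at d2 d4 ⊢
      have hbep : 0 < b * e * x 1 u := by positivity
      have hcdp : 0 < c * d * x 1 u := by positivity
      constructor
      · intro p2
        by_contra p4
        have q4 := d4.resolve_left p4
        have := mul_le_mul p2 q4 (by positivity) (by positivity)
        have hu := mul_le_mul_of_nonneg_right (by linarith : c * d ≤ 2 * (b * e))
          (zero_le_one.trans x1u)
        linarith
      · intro p4
        by_contra p2
        have q2 := d2.resolve_left p2
        have := mul_le_mul p4 q2 (by positivity) (by positivity)
        have hu := mul_le_mul_of_nonneg_right (by linarith : b * e ≤ 2 * (c * d))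
          (zero_le_one.trans x1u)
        linarith
    refine ⟨2, fun u hu v hv huv => ?_⟩
    rw [key u hu, key v hv]
    exact huv 4 (by decide)
  -- Now `a * f` lies between `b * c / x 1 n` and `2 * (b * c)`, so the critical values `a / b` and
  -- `c / f` of `x 2` are close on the scale of the margins, and thresholds 1 and 3 coincide.
  · have hbc1 : b * c ≤ b * e * x 1 n := by
      rw [mul_assoc]
      exact mul_le_mul_of_nonneg_left hce b0
    have hbc2 : b * c ≤ c * d * x 1 n := by
      rw [mul_assoc, mul_comm b]
      exact mul_le_mul_of_nonneg_left hbd c0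
    have hbc : b * c ≤ a * f * x 1 n := by
      by_contra hcon
      have hX0 := zero_le_one.trans hX
      exact hA ⟨(lt_of_mul_lt_mul_right (by linarith) hX0).le,
        (lt_of_mul_lt_mul_right (by linarith) hX0).le⟩
    have haf : a * f ≤ 2 * (b * c) := by
      linarith [mul_le_mul_of_nonneg_left hec b0, mul_le_mul_of_nonneg_left hdb c0]
    have key : ∀ u ∈ decidedIndices P n x, Passes P n x 1 u ↔ Passes P n x 3 u := by
      intro u hu
      rw [mem_decidedIndices] at hu
      have d1 := hu.2 1
      have d3 := hu.2 3
      have x2u := h.one_le_two hu.1.1 hu.1.2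
      simp only [Decided, Passes, thresholdFactor, thresholdConst, thresholdCoeff, thresholdAxis,
        Matrix.cons_val, ← ha, ← hb, ← hc, ← hd, ← he, ← hf, max_eq_left hdb,
        max_eq_left hec] at d1 d3 ⊢
      have hbcp : 0 < b * c * x 2 u := by positivity
      have hK : 64 * x 1 n ≤ (8 * x 1 n) ^ 2 := by nlinarith
      have hafp : 0 ≤ a * f * x 2 u := by positivity
      have hKK : 64 * x 1 n ≤ (8 * x 1 n) ^ 2 * (8 * x 1 n) ^ 2 :=
        hK.trans (le_mul_of_one_le_left (by positivity) (by linarith))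
      have hbcu := mul_le_mul_of_nonneg_right hbc (by linarith : 0 ≤ x 2 u)
      have hafu := mul_le_mul_of_nonneg_right haf (by linarith : 0 ≤ x 2 u)
      constructor
      · intro p1
        by_contra p3
        have q3 := d3.resolve_left p3
        have e1 := mul_le_mul p1 q3 (by positivity) (by positivity)
        have e2 := mul_le_mul_of_nonneg_right hKK hafp
        linarith
      · intro p3
        by_contra p1
        have q1 := d1.resolve_left p1
        have e1 := mul_le_mul p3 q1 (by positivity) (by positivity)
        have e2 := mul_le_mul_of_nonneg_right (hKK.trans' (by linarith : 64 ≤ 64 * x 1 n)) hbcp.le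
        linarith
    refine ⟨1, fun u hu v hv huv => ?_⟩
    rw [key u hu, key v hv]
    exact huv 3 (by decide)

end

/-! ### Lines, stabbed triangles and the count -/

/-- The Plücker coordinates `01, 02, 03, 12, 13, 23` of the line through `q` with direction `w`. -/
def plucker (q w : EuclideanSpace ℝ (Fin 3)) : Fin 6 → ℝ :=
  ![q 1 * w 2 - q 2 * w 1, q 2 * w 0 - q 0 * w 2, q 0 * w 1 - q 1 * w 0, w 2, -w 1, w 0]

/-- The determinant of `p_s - q`, `p_t - q` and `w`, where `p_j` are the points of the diagonal. -/
def lineForm (q w : EuclideanSpace ℝ (Fin 3)) (x : ℕ → ℕ → ℝ) (s t : ℕ) : ℝ :=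
  ∑ i, plucker q w i * minors x s t i

lemma lineForm_swap (q w : EuclideanSpace ℝ (Fin 3)) (x : ℕ → ℕ → ℝ) (s t : ℕ) :
    lineForm q w x t s = -lineForm q w x s t := by
  simp [lineForm, plucker, minors, Fin.sum_univ_succ]
  ring

lemma plucker_relation (q w : EuclideanSpace ℝ (Fin 3)) :
    plucker q w 0 * plucker q w 5 - plucker q w 1 * plucker q w 4 +
      plucker q w 2 * plucker q w 3 = 0 := by
  simp [plucker]
  ring

lemma exists_plucker_ne_zero (q : EuclideanSpace ℝ (Fin 3)) {w : EuclideanSpace ℝ (Fin 3)}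
    (hw : w ≠ 0) : ∃ i, plucker q w i ≠ 0 := by
  by_contra! h
  apply hw
  ext i
  fin_cases i
  · simpa [plucker] using h 5
  · simpa [plucker] using h 4
  · simpa [plucker] using h 3

lemma exists_line_param {L : AffineSubspace ℝ (EuclideanSpace ℝ (Fin 3))} (hL : IsFlat 1 L) :
    ∃ q w : EuclideanSpace ℝ (Fin 3), w ≠ 0 ∧ ∀ y ∈ L, ∃ μ : ℝ, y = q + μ • w := by
  obtain ⟨⟨q, hq⟩, h1⟩ := hL
  obtain ⟨w, hw, hspan⟩ := finrank_eq_one_iff'.1 h1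
  refine ⟨q, w, by simpa using hw, fun y hy => ?_⟩
  obtain ⟨μ, hμ⟩ := hspan ⟨y -ᵥ q, AffineSubspace.vsub_mem_direction hy hq⟩
  refine ⟨μ, ?_⟩
  have := congrArg Subtype.val hμ
  simp only [Submodule.coe_smul, vsub_eq_sub] at this
  rw [this]
  abel

/-- The `j`-th point of the stretched diagonal in `ℝ^3`. -/
def diagPoint (x : ℕ → ℕ → ℝ) (j : ℕ) : EuclideanSpace ℝ (Fin 3) :=
  WithLp.toLp 2 fun i : Fin 3 => x ((i : ℕ) + 1) j

lemma mem_stretchedDiagonal {n : ℕ} {x : ℕ → ℕ → ℝ} {y : EuclideanSpace ℝ (Fin 3)} :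
    y ∈ stretchedDiagonal 3 n x ↔ ∃ j, (1 ≤ j ∧ j ≤ n) ∧ diagPoint x j = y := by
  simp [stretchedDiagonal, diagPoint]

lemma exists_weights_of_mem_convexHull {E : Type*} [AddCommGroup E] [Module ℝ E] {p q r y : E}
    (hy : y ∈ convexHull ℝ ({p, q, r} : Set E)) :
    ∃ a b c : ℝ, 0 ≤ a ∧ 0 ≤ b ∧ 0 ≤ c ∧ a + b + c = 1 ∧ a • p + b • q + c • r = y := by
  rw [convexHull_insert (by simp), convexHull_pair, mem_convexJoin] at hy
  obtain ⟨p', hp', z, ⟨u, v, hu, hv, huv, rfl⟩, ⟨s, t, hs, ht, hst, rfl⟩⟩ := hy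
  rw [Set.mem_singleton_iff.1 hp']
  refine ⟨s, t * u, t * v, hs, by positivity, by positivity, ?_, ?_⟩
  · rw [add_assoc, ← mul_add, huv, mul_one, hst]
  · rw [smul_add, smul_smul, smul_smul, add_assoc]

/-- If a line meets the triangle with vertices `p_a, p_b, p_c`, then these are arranged cyclically
around the line or the form of the line vanishes on two of them. -/
lemma cyclic_of_stabs {q w : EuclideanSpace ℝ (Fin 3)} {x : ℕ → ℕ → ℝ} {a b c : ℕ} {μ : ℝ}
    (hy : q + μ • w ∈ convexHull ℝ
      ({diagPoint x a, diagPoint x b, diagPoint x c} : Set (EuclideanSpace ℝ (Fin 3))))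
    (hab : lineForm q w x a b ≠ 0) (hac : lineForm q w x a c ≠ 0)
    (hbc : lineForm q w x b c ≠ 0) :
    0 < lineForm q w x a b * lineForm q w x b c ∧
      lineForm q w x a b * lineForm q w x a c < 0 := by
  obtain ⟨α, β, γ, hα, hβ, hγ, hsum, hcomb⟩ := exists_weights_of_mem_convexHull hy
  have e0 : α * x 1 a + β * x 1 b + γ * x 1 c = q 0 + μ * w 0 := by
    simpa [diagPoint] using congrArg (fun v : EuclideanSpace ℝ (Fin 3) => v 0) hcomb
  have e1 : α * x 2 a + β * x 2 b + γ * x 2 c = q 1 + μ * w 1 := by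
    simpa [diagPoint] using congrArg (fun v : EuclideanSpace ℝ (Fin 3) => v 1) hcomb
  have e2 : α * x 3 a + β * x 3 b + γ * x 3 c = q 2 + μ * w 2 := by
    simpa [diagPoint] using congrArg (fun v : EuclideanSpace ℝ (Fin 3) => v 2) hcomb
  -- The form is affine in its second point and vanishes at points of the line; apply this to the
  -- convex combination on the line.
  have key : ∀ j, α * lineForm q w x j a + β * lineForm q w x j b + γ * lineForm q w x j c = 0 := by
    intro j
    simp [lineForm, plucker, minors, Fin.sum_univ_succ]
    obtain rfl : γ = 1 - α - β := by linarith
    linear_combination (w 1 * (x 3 j - q 2) - w 2 * (x 2 j - q 1)) * e0 +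
      (w 2 * (x 1 j - q 0) - w 0 * (x 3 j - q 2)) * e1 +
      (w 0 * (x 2 j - q 1) - w 1 * (x 1 j - q 0)) * e2
  have saa : ∀ j, lineForm q w x j j = 0 := fun j => by linarith [lineForm_swap q w x j j]
  have ka := key a
  have kb := key b
  have kc := key c
  rw [saa] at ka kb kc
  rw [lineForm_swap q w x a b] at kb
  rw [lineForm_swap q w x a c, lineForm_swap q w x b c] at kc
  generalize lineForm q w x a b = X at *
  generalize lineForm q w x a c = Y at *
  generalize lineForm q w x b c = Z at *
  have hγ0 : γ ≠ 0 := by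
    rintro rfl
    have h1 : β = 0 := by simpa [hab] using (by linarith : β * X = 0)
    have h2 : α = 0 := by simpa [hab] using (by linarith : α * X = 0)
    linarith
  have hγ' : 0 < γ := lt_of_le_of_ne hγ hγ0.symm
  constructor
  · have : 0 < α * (X * Z) := by
      have : α * (X * Z) = γ * Z ^ 2 := by linear_combination -Z * kb
      rw [this]
      positivity
    exact pos_of_mul_pos_right this hα
  · have : 0 < β * -(X * Y) := by
      have : β * -(X * Y) = γ * Y ^ 2 := by linear_combination -Y * ka
      rw [this]
      positivity
    linarith [pos_of_mul_pos_right this hβ]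

/-- A set of three values of a function on `ℕ` is taken at an increasing triple. -/
lemma exists_lt_lt_of_card_eq_three {E : Type*} [DecidableEq E] {T : Finset E} (hT : T.card = 3)
    {I : Set ℕ} {p : ℕ → E} (h : ∀ y ∈ T, ∃ j ∈ I, p j = y) :
    ∃ a ∈ I, ∃ b ∈ I, ∃ c ∈ I, a < b ∧ b < c ∧ T = {p a, p b, p c} := by
  classical
  choose! j hj hp using h
  have hinj : Set.InjOn j T := fun u hu v hv huv => by rw [← hp u hu, huv, hp v hv]
  have hcard : (T.image j).card = 3 := by rw [Finset.card_image_of_injOn hinj, hT]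
  let o := (T.image j).orderEmbOfFin hcard
  have ho : ∀ i, o i ∈ I := fun i => by
    obtain ⟨u, hu, h⟩ := Finset.mem_image.1 ((T.image j).orderEmbOfFin_mem hcard i)
    exact h ▸ hj u hu
  refine ⟨o 0, ho 0, o 1, ho 1, o 2, ho 2, o.strictMono (by decide), o.strictMono (by decide), ?_⟩
  have h1 : T = (T.image j).image p := by
    rw [Finset.image_image]
    conv_lhs => rw [← Finset.image_id (s := T)]
    exact Finset.image_congr fun u hu => (hp u hu).symm
  have h2 : T.image j = {o 0, o 1, o 2} := by
    rw [← Finset.coe_inj, ← Finset.range_orderEmbOfFin (T.image j) hcard]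
    ext u
    rw [Set.mem_range]
    simp [-Finset.range_orderEmbOfFin, Fin.exists_fin_succ, o, eq_comm]
  rw [h1, h2]
  simp [Finset.image_insert]

/-- Every line stabs at most `n ^ 3 / 25 + 60 n ^ 2` triangles of the stretched diagonal. -/
theorem stabCount_stretchedDiagonal_le {n : ℕ} {x : ℕ → ℕ → ℝ} (h : IsStretched 3 n x)
    {L : AffineSubspace ℝ (EuclideanSpace ℝ (Fin 3))} (hL : IsFlat 1 L) :
    (stabCount 2 (stretchedDiagonal 3 n x) L : ℝ) ≤ 1 / 25 * (n : ℝ) ^ 3 + 60 * (n : ℝ) ^ 2 := by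
  classical
  obtain ⟨q, w, hw, hqw⟩ := exists_line_param hL
  set P := plucker q w
  set G := decidedIndices P n x
  set D := lineForm q w x with hDdef
  set I := Finset.Icc 1 n
  set B := I \ G
  have hGI : G ⊆ I := Finset.filter_subset _ _
  have hsign : ∀ a ∈ G, ∀ b ∈ G, a < b → 0 < P (leadIndex (Passes P n x) a b) * D a b := by
    intro a ha b hb hab
    have ha := mem_decidedIndices.1 ha
    have hb := mem_decidedIndices.1 hb
    exact sign_eq_lead h (exists_plucker_ne_zero q hw) ha.1.1 hab hb.1.2 ha.2 hb.2
  have hD0 : ∀ a ∈ G, ∀ b ∈ G, a < b → D a b ≠ 0 := fun a ha b hb hab h0 => by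
    simpa [h0] using hsign a ha b hb hab
  obtain ⟨k₀, hk₀⟩ := exists_redundant_threshold h (plucker_relation q w)
  obtain ⟨cls, hmono, hcls⟩ := exists_interval_classes G (Passes P n x)
    (fun k s hs t ht hst hp => hp.mono h (mem_decidedIndices.1 hs).1.1 hst
      (mem_decidedIndices.1 ht).1.2) k₀ hk₀
  have hcyc := card_cyclic_triples_le G D cls hmono (by
    intro a ha b hb a' ha' b' hb' hab hab' h1 h2
    have e : leadIndex (Passes P n x) a b = leadIndex (Passes P n x) a' b' := by
      have h1 := hcls a ha a' ha' h1
      have h2 := hcls b hb b' hb' h2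
      simp only [leadIndex, h1, h2]
    have s1 := hsign a ha b hb hab
    have s2 := hsign a' ha' b' hb' hab'
    -- Both values of `D` have the sign of the same Plücker coordinate.
    rw [← e] at s2
    have := mul_pos s1 s2
    rw [mul_mul_mul_comm] at this
    exact pos_of_mul_pos_right this (mul_self_nonneg _))
  set C := (G ×ˢ G ×ˢ G).filter fun u => u.1 < u.2.1 ∧ u.2.1 < u.2.2 ∧
    0 < D u.1 u.2.1 * D u.2.1 u.2.2 ∧ D u.1 u.2.1 * D u.1 u.2.2 < 0
  let S : Finset (ℕ × ℕ × ℕ) := C ∪ (B ×ˢ I ×ˢ I ∪ (I ×ˢ B ×ˢ I ∪ I ×ˢ I ×ˢ B))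
  have hcount : stabCount 2 (stretchedDiagonal 3 n x) L ≤ S.card := by
    refine le_trans ?_ (Finset.card_image_le (s := S) (f := fun u =>
      ({diagPoint x u.1, diagPoint x u.2.1, diagPoint x u.2.2} :
        Finset (EuclideanSpace ℝ (Fin 3)))))
    rw [← Set.ncard_coe_finset]
    refine Set.ncard_le_ncard ?_ (Finset.finite_toSet _)
    rintro T ⟨hTX, hT, -, y, hyT, hyL⟩
    obtain ⟨a, ha, b, hb, c, hc, hab, hbc, rfl⟩ :=
      exists_lt_lt_of_card_eq_three (I := (I : Set ℕ)) (p := diagPoint x) hT (fun y hy => by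
        obtain ⟨j, hj, rfl⟩ := mem_stretchedDiagonal.1 (hTX hy)
        exact ⟨j, Finset.mem_coe.2 (Finset.mem_Icc.2 hj), rfl⟩)
    rw [Finset.mem_coe] at ha hb hc
    refine Finset.mem_coe.2 (Finset.mem_image.2 ⟨(a, b, c), ?_, rfl⟩)
    by_cases hG : a ∈ G ∧ b ∈ G ∧ c ∈ G
    · obtain ⟨ga, gb, gc⟩ := hG
      obtain ⟨μ, rfl⟩ := hqw y hyL
      refine Finset.mem_union_left _ (Finset.mem_filter.2 ⟨by simp [ga, gb, gc], hab, hbc, ?_⟩)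
      refine cyclic_of_stabs (μ := μ) (by simpa using hyT) (hD0 a ga b gb hab)
        (hD0 a ga c gc (hab.trans hbc)) (hD0 b gb c gc hbc)
    · refine Finset.mem_union_right _ ?_
      simp only [Finset.mem_union, Finset.mem_product, B, Finset.mem_sdiff, ha, hb, hc]
      tauto
  have hB : B.card ≤ 20 := card_sdiff_decidedIndices_le h P
  have hI : I.card = n := by simp [I]
  -- Three positions for one of at most 20 discarded indices, and `n ^ 2` choices for the rest.
  have hS : S.card ≤ C.card + 60 * n ^ 2 := by
    refine (Finset.card_union_le _ _).trans (Nat.add_le_add_left ?_ _)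
    refine (Finset.card_union_le _ _).trans ((Nat.add_le_add_left
      (Finset.card_union_le _ _) _).trans ?_)
    simp only [Finset.card_product, hI]
    nlinarith [Nat.mul_le_mul_right (n ^ 2) hB]
  have hG : (G.card : ℝ) ≤ n := by
    exact_mod_cast hI ▸ Finset.card_le_card hGI
  have h3 : (G.card : ℝ) ^ 3 ≤ (n : ℝ) ^ 3 := pow_le_pow_left₀ (by positivity) hG 3
  have h4 : (stabCount 2 (stretchedDiagonal 3 n x) L : ℝ) ≤ C.card + 60 * (n : ℝ) ^ 2 := by
    exact_mod_cast hcount.trans hS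
  linarith

/-! ### General position of the stretched diagonal -/

/-- A homogeneous linear system of three equations with nonzero determinant has no nonzero
solution. -/
lemma eq_zero_of_det_ne_zero {a₁ b₁ c₁ a₂ b₂ c₂ a₃ b₃ c₃ β γ δ : ℝ}
    (h₁ : β * a₁ + γ * b₁ + δ * c₁ = 0) (h₂ : β * a₂ + γ * b₂ + δ * c₂ = 0)
    (h₃ : β * a₃ + γ * b₃ + δ * c₃ = 0)
    (hdet : a₁ * b₂ * c₃ - a₁ * c₂ * b₃ - b₁ * a₂ * c₃ + b₁ * c₂ * a₃ + c₁ * a₂ * b₃ -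
      c₁ * b₂ * a₃ ≠ 0) : β = 0 ∧ γ = 0 ∧ δ = 0 := by
  refine ⟨?_, ?_, ?_⟩ <;> refine (mul_eq_zero.1 ?_).resolve_left hdet
  · linear_combination (b₂ * c₃ - c₂ * b₃) * h₁ + (c₁ * b₃ - b₁ * c₃) * h₂ +
      (b₁ * c₂ - c₁ * b₂) * h₃
  · linear_combination (c₂ * a₃ - a₂ * c₃) * h₁ + (a₁ * c₃ - c₁ * a₃) * h₂ +
      (c₁ * a₂ - a₁ * c₂) * h₃
  · linear_combination (a₂ * b₃ - b₂ * a₃) * h₁ + (b₁ * a₃ - a₁ * b₃) * h₂ +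
      (a₁ * b₂ - b₁ * a₂) * h₃

section

variable {n : ℕ} {x : ℕ → ℕ → ℝ}

lemma diff_bounds (h : IsStretched 3 n x) {s t : ℕ} (hs : 1 ≤ s) (hst : s < t) (ht : t ≤ n)
    (i : ℕ) (hi : i = 1 ∨ i = 2 ∨ i = 3) :
    7 / 8 * x i t ≤ x i t - x i s ∧ 0 ≤ x i t - x i s ∧ x i t - x i s ≤ x i t := by
  have b := minors_bounds h hs hst ht
  rcases hi with rfl | rfl | rfl
  · have := b 0
    simp only [minors, diagTerms, Matrix.cons_val] at this
    exact ⟨by linarith, by linarith, by linarith⟩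
  · have := b 1
    simp only [minors, diagTerms, Matrix.cons_val] at this
    exact ⟨by linarith, by linarith, by linarith⟩
  · have := b 2
    simp only [minors, diagTerms, Matrix.cons_val] at this
    exact ⟨by linarith, by linarith, by linarith⟩

/-- Four points of a stretched diagonal are not coplanar. -/
lemma det_diffs_pos (h : IsStretched 3 n x) {a b c d : ℕ} (ha : 1 ≤ a) (hab : a < b) (hbc : b < c)
    (hcd : c < d) (hd : d ≤ n) :
    0 < (x 1 b - x 1 a) * (x 2 c - x 2 a) * (x 3 d - x 3 a) -
      (x 1 b - x 1 a) * (x 2 d - x 2 a) * (x 3 c - x 3 a) -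
      (x 1 c - x 1 a) * (x 2 b - x 2 a) * (x 3 d - x 3 a) +
      (x 1 c - x 1 a) * (x 2 d - x 2 a) * (x 3 b - x 3 a) +
      (x 1 d - x 1 a) * (x 2 b - x 2 a) * (x 3 c - x 3 a) -
      (x 1 d - x 1 a) * (x 2 c - x 2 a) * (x 3 b - x 3 a) := by
  have l1 := h.one_le_one (by omega : 1 ≤ b) (by omega)
  have l2 := h.one_le_two (by omega : 1 ≤ c) (by omega)
  have l2b := h.one_le_two (by omega : 1 ≤ b) (by omega)
  have l3b := h.one_le_three (by omega : 1 ≤ b) (by omega)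
  have l3c := h.one_le_three (by omega : 1 ≤ c) (by omega)
  have l3 := h.one_le_three (by omega : 1 ≤ d) (by omega)
  have l1c := h.one_le_one (by omega : 1 ≤ c) (by omega)
  have m1c := h.mono_one (by omega : 1 ≤ c) (by omega) le_rfl
  have m1d := h.mono_one (by omega : 1 ≤ d) (by omega) le_rfl
  have m2d := h.mono_two (by omega : 1 ≤ d) (by omega) le_rfl
  have g2 := h.factor_two_mul_le (by omega : 1 ≤ b) hbc (by omega)
  have g3 := h.factor_three_mul_le (by omega : 1 ≤ c) hcd hd
  have g3' := h.mono_three (by omega : 1 ≤ b) hbc.le (by omega)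
  have u12 : x 1 n ≤ x 2 n := by
    have := h.factor_two_mul_le ha hab (by omega)
    have := h.one_le_two ha (by omega)
    have := h.mono_two (by omega : 1 ≤ b) (by omega) le_rfl
    nlinarith
  have B1 := diff_bounds h ha hab (by omega) 1 (by simp)
  have B2 := diff_bounds h ha hab (by omega) 2 (by simp)
  have B3 := diff_bounds h ha hab (by omega) 3 (by simp)
  have C1 := diff_bounds h ha (hab.trans hbc) (by omega) 1 (by simp)
  have C2 := diff_bounds h ha (hab.trans hbc) (by omega) 2 (by simp)
  have C3 := diff_bounds h ha (hab.trans hbc) (by omega) 3 (by simp)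
  have D1 := diff_bounds h ha ((hab.trans hbc).trans hcd) hd 1 (by simp)
  have D2 := diff_bounds h ha ((hab.trans hbc).trans hcd) hd 2 (by simp)
  have D3 := diff_bounds h ha ((hab.trans hbc).trans hcd) hd 3 (by simp)
  -- Two off-diagonal products enter with a plus sign and are dropped. Each of the three others is
  -- at most `1 / 8` of `x 1 b * x 2 c * x 3 d`, while the diagonal one is at least `(7 / 8) ^ 3 > 3
  -- / 8` of it.
  have p1 : 0 ≤ (x 1 c - x 1 a) * (x 2 d - x 2 a) * (x 3 b - x 3 a) :=
    mul_nonneg (mul_nonneg C1.2.1 D2.2.1) B3.2.1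
  have p2 : 0 ≤ (x 1 d - x 1 a) * (x 2 b - x 2 a) * (x 3 c - x 3 a) :=
    mul_nonneg (mul_nonneg D1.2.1 B2.2.1) C3.2.1
  have lead : 7 / 8 * x 1 b * (7 / 8 * x 2 c) * (7 / 8 * x 3 d) ≤
      (x 1 b - x 1 a) * (x 2 c - x 2 a) * (x 3 d - x 3 a) :=
    mul_le_mul (mul_le_mul B1.1 C2.1 (by positivity) B1.2.1) D3.1 (by positivity)
      (mul_nonneg B1.2.1 C2.2.1)
  have n1 : (x 1 b - x 1 a) * (x 2 d - x 2 a) * (x 3 c - x 3 a) ≤ x 1 b * x 2 n * x 3 c :=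
    mul_le_mul (mul_le_mul B1.2.2 (D2.2.2.trans m2d) D2.2.1 (by linarith)) C3.2.2 C3.2.1
      (mul_nonneg (by linarith) (by linarith))
  have n2 : (x 1 c - x 1 a) * (x 2 b - x 2 a) * (x 3 d - x 3 a) ≤ x 1 n * x 2 b * x 3 d :=
    mul_le_mul (mul_le_mul (C1.2.2.trans m1c) B2.2.2 B2.2.1 (by linarith)) D3.2.2 D3.2.1
      (mul_nonneg (by linarith) (by linarith))
  have n3 : (x 1 d - x 1 a) * (x 2 c - x 2 a) * (x 3 b - x 3 a) ≤ x 2 n * x 2 c * x 3 c :=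
    mul_le_mul (mul_le_mul (D1.2.2.trans (m1d.trans u12)) C2.2.2 C2.2.1 (by linarith))
      (B3.2.2.trans g3') B3.2.1 (mul_nonneg (by linarith) (by linarith))
  have M0 : 0 < x 1 b * x 2 c * x 3 d := by positivity
  have q1 : 8 * (x 1 b * x 2 n * x 3 c) ≤ x 1 b * x 2 c * x 3 d := by
    have e1 := mul_le_mul_of_nonneg_left g3 (by linarith : 0 ≤ x 1 b)
    have e2 := mul_le_mul_of_nonneg_right (le_mul_of_one_le_right (by linarith : 0 ≤ x 1 b) l2)
      (by linarith : 0 ≤ x 3 d)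
    linarith
  have q2 : 8 * (x 1 n * x 2 b * x 3 d) ≤ x 1 b * x 2 c * x 3 d := by
    have e1 := mul_le_mul_of_nonneg_right g2 (by linarith : 0 ≤ x 3 d)
    have e2 := mul_le_mul_of_nonneg_right (le_mul_of_one_le_left (by linarith : 0 ≤ x 2 c) l1)
      (by linarith : 0 ≤ x 3 d)
    linarith
  have q3 : 8 * (x 2 n * x 2 c * x 3 c) ≤ x 1 b * x 2 c * x 3 d := by
    have e1 := mul_le_mul_of_nonneg_left g3 (by linarith : 0 ≤ x 2 c)
    have e2 := mul_le_mul_of_nonneg_right (le_mul_of_one_le_left (by linarith : 0 ≤ x 2 c) l1)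
      (by linarith : 0 ≤ x 3 d)
    linarith
  linarith

/-- Eliminating the weight of the first point turns an affine dependence into a kernel vector of the
matrix of differences, whose determinant is positive. -/
lemma affineIndependent_diagPoint (h : IsStretched 3 n x) {o : Fin 4 → ℕ} (ho : StrictMono o)
    (h0 : ∀ i, 1 ≤ o i ∧ o i ≤ n) : AffineIndependent ℝ fun i => diagPoint x (o i) := by
  classical
  rw [affineIndependent_iff]
  intro s w hw hp
  set v : Fin 4 → ℝ := fun i => if i ∈ s then w i else 0
  have hv : ∑ i, v i = 0 := by simpa [v, Finset.sum_ite_mem] using hw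
  have hvp : ∑ i, v i • diagPoint x (o i) = 0 := by
    simpa [v, ite_smul, Finset.sum_ite_mem] using hp
  have e1 : ∑ i, v i * x 1 (o i) = 0 := by
    simpa [diagPoint] using congrArg (fun u : EuclideanSpace ℝ (Fin 3) => u 0) hvp
  have e2 : ∑ i, v i * x 2 (o i) = 0 := by
    simpa [diagPoint] using congrArg (fun u : EuclideanSpace ℝ (Fin 3) => u 1) hvp
  have e3 : ∑ i, v i * x 3 (o i) = 0 := by
    simpa [diagPoint] using congrArg (fun u : EuclideanSpace ℝ (Fin 3) => u 2) hvp
  rw [Fin.sum_univ_four] at hv e1 e2 e3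
  have hdet := det_diffs_pos h (h0 0).1 (ho (by decide : (0 : Fin 4) < 1))
    (ho (by decide : (1 : Fin 4) < 2)) (ho (by decide : (2 : Fin 4) < 3)) (h0 3).2
  obtain ⟨v1, v2, v3⟩ := eq_zero_of_det_ne_zero (β := v 1) (γ := v 2) (δ := v 3)
    (a₁ := x 1 (o 1) - x 1 (o 0)) (b₁ := x 1 (o 2) - x 1 (o 0))
    (c₁ := x 1 (o 3) - x 1 (o 0)) (a₂ := x 2 (o 1) - x 2 (o 0)) (b₂ := x 2 (o 2) - x 2 (o 0))
    (c₂ := x 2 (o 3) - x 2 (o 0)) (a₃ := x 3 (o 1) - x 3 (o 0)) (b₃ := x 3 (o 2) - x 3 (o 0))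
    (c₃ := x 3 (o 3) - x 3 (o 0))
    (by linear_combination e1 - x 1 (o 0) * hv) (by linear_combination e2 - x 2 (o 0) * hv)
    (by linear_combination e3 - x 3 (o 0) * hv) (by
      refine ne_of_gt (hdet.trans_eq ?_)
      ring)
  have hall : ∀ i, v i = 0 := by
    have v0 : v 0 = 0 := by linarith
    intro i
    fin_cases i
    exacts [v0, v1, v2, v3]
  intro i hi
  simpa [v, hi] using hall i

lemma diagPoint_injOn (h : IsStretched 3 n x) :
    Set.InjOn (diagPoint x) (Finset.Icc 1 n : Finset ℕ) := by
  have key : ∀ s t, 1 ≤ s → s < t → t ≤ n → diagPoint x s ≠ diagPoint x t := by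
    intro s t hs hst ht he
    have e : x 1 s = x 1 t := by
      simpa [diagPoint] using congrArg (fun u : EuclideanSpace ℝ (Fin 3) => u 0) he
    linarith [h.eight_mul_le hs hst ht, h.one_le_one hs (by omega)]
  intro s hs t ht he
  rw [Finset.mem_coe, Finset.mem_Icc] at hs ht
  rcases lt_trichotomy s t with hl | hl | hl
  · exact (key s t hs.1 hl ht.2 he).elim
  · exact hl
  · exact (key t s ht.1 hl hs.2 he.symm).elim

lemma stretchedDiagonal_eq_image (n : ℕ) (x : ℕ → ℕ → ℝ) :
    stretchedDiagonal 3 n x = (Finset.Icc 1 n).image (diagPoint x) := by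
  ext y
  rw [mem_stretchedDiagonal, Finset.mem_image]
  simp

lemma card_stretchedDiagonal (h : IsStretched 3 n x) : (stretchedDiagonal 3 n x).card = n := by
  rw [stretchedDiagonal_eq_image, Finset.card_image_of_injOn (diagPoint_injOn h)]
  simp

lemma inGeneralPosition_stretchedDiagonal (h : IsStretched 3 n x) (hn : 4 ≤ n) :
    InGeneralPosition (stretchedDiagonal 3 n x) := by
  intro T hT hcard
  -- Enlarging `T` to exactly four points, possible as `4 ≤ n`, leaves only quadruples to check.
  obtain ⟨U, hTU, hU, hU4⟩ := Finset.exists_subsuperset_card_eq hT hcard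
    (by rw [card_stretchedDiagonal h]; exact hn)
  obtain ⟨J, hJ, rfl⟩ := Finset.subset_image_iff.1 (stretchedDiagonal_eq_image n x ▸ hU)
  have hJ4 : J.card = 4 := by
    rw [Finset.card_image_of_injOn ((diagPoint_injOn h).mono hJ)] at hU4
    exact hU4
  have hind := affineIndependent_diagPoint h (J.orderEmbOfFin hJ4).strictMono fun i =>
    Finset.mem_Icc.1 (hJ (J.orderEmbOfFin_mem hJ4 i))
  refine hind.range.mono fun y hy => ?_
  obtain ⟨j, hj, rfl⟩ := Finset.mem_image.1 (hTU hy)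
  rw [← Finset.mem_coe, ← J.range_orderEmbOfFin hJ4] at hj
  obtain ⟨i, rfl⟩ := hj
  exact ⟨i, rfl⟩

end

/-! ### The selection constant -/

/-- Stretched diagonals of every size exist. -/
lemma exists_isStretched (n : ℕ) : ∃ x, IsStretched 3 n x := by
  let A : ℕ → ℝ := fun j => 8 ^ (j - 1)
  let B : ℕ → ℝ := fun j => (8 * A n) ^ (j - 1)
  let C : ℕ → ℝ := fun j => (8 * B n) ^ (j - 1)
  have hpow : ∀ (K : ℝ) (j : ℕ), 1 ≤ j → K * K ^ (j - 1) = K ^ (j + 1 - 1) := by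
    intro K j hj
    rw [← pow_succ']
    congr 1
    omega
  refine ⟨fun i => if i = 1 then A else if i = 2 then B else C, ⟨?_, ?_⟩⟩
  · intro i h1 h3
    interval_cases i <;> simp [A, B, C]
  · intro i j h1 h3 hj hjn
    interval_cases i <;> norm_num [growthFactor]
    · exact (hpow 8 j hj).le
    · exact (hpow _ j hj).le
    · exact (hpow _ j hj).le

lemma le_of_mem_selectionConstants {c : ℝ} (hc : c ∈ selectionConstants 3 1) : c ≤ 1 / 25 := by
  obtain ⟨C, hC⟩ := hc
  have key : ∀ n : ℕ, 4 ≤ n → c - 1 / 25 ≤ (60 + C) / n := by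
    intro n hn
    obtain ⟨x, hx⟩ := exists_isStretched n
    obtain ⟨L, hL, hle⟩ := hC _ (inGeneralPosition_stretchedDiagonal hx hn)
    rw [card_stretchedDiagonal hx] at hle
    have hn0 : (0 : ℝ) < n := by exact_mod_cast (by omega : 0 < n)
    have h1 : c * (n : ℝ) ^ 3 - C * (n : ℝ) ^ 2 ≤ 1 / 25 * (n : ℝ) ^ 3 + 60 * (n : ℝ) ^ 2 :=
      hle.trans (stabCount_stretchedDiagonal_le hx hL)
    rw [le_div_iff₀ hn0]
    refine le_of_mul_le_mul_right ?_ (pow_pos hn0 2)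
    linarith
  have hlim : Tendsto (fun n : ℕ => (60 + C) / (n : ℝ)) atTop (nhds 0) :=
    tendsto_const_div_atTop_nhds_zero_nat _
  have := ge_of_tendsto hlim (eventually_atTop.2 ⟨4, key⟩)
  linarith

theorem mainTheorem4 :
    (∃ e : ℕ → ℝ, e =o[atTop] (fun n : ℕ => (n : ℝ) ^ 3) ∧
      ∀ (n : ℕ) (x : ℕ → ℕ → ℝ), IsStretched 3 n x →
        ∀ L : AffineSubspace ℝ (EuclideanSpace ℝ (Fin 3)), IsFlat 1 L →
          (stabCount 2 (stretchedDiagonal 3 n x) L : ℝ) ≤ 1 / 25 * (n : ℝ) ^ 3 + e n) ∧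
    (BddAbove (selectionConstants 3 1) ∧ selectionConstant 3 1 ≤ 1 / 25) := by
  refine ⟨⟨fun n => 60 * (n : ℝ) ^ 2, ?_, fun n x hx L hL => stabCount_stretchedDiagonal_le hx hL⟩,
    ⟨1 / 25, fun c hc => le_of_mem_selectionConstants hc⟩,
    -- No member of the set is needed: the real supremum of the empty set is 0, which the
    -- nonnegative bound covers.
    Real.sSup_le (fun c hc => le_of_mem_selectionConstants hc) (by norm_num)⟩
  exact ((isLittleO_pow_pow_atTop_of_lt (by norm_num : 2 < 3)).comp_tendsto
    tendsto_natCast_atTop_atTop).const_mul_left 60
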